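/- Let $d,N\in\mathbb N$. For $i=1,\dots,d$ let $p_i\in(0,1]$ and let $\psi_i$ be a probability density on $(0,\infty)$ with cdf $\Psi_i(x)=\int_0^x\psi_i$, and put $$F_i(x;p_i)=(1-p_i)\,\mathbf 1_{\{x\ge 0\}}+p_i\,\Psi_i(x)\,\mathbf 1_{\{x>0\}} .$$ Let $C$ be a $d$-dimensional absolutely continuous copula, i.e. the distribution function on $[0,1]^d$ of a probability measure that has uniform margins on $[0,1]$ and is absolutely continuous with respect to Lebesgue measure. A $d$-dimensional Comb-Bernoulli time series of length $N$ is a family of independent random vectors $X^{(1)},\dots,X^{(N)}$ in $\mathbb R^d$ with $$\mathbb P\big(X^{(t)}_1\le x_1,\dots,X^{(t)}_d\le x_d\big)=C\big(F_1(x_1;p_1),\dots,F_d(x_d;p_d)\big)\qquad(x\in\mathbb R^d).$$ For $x\in[0,\infty)^d$ let $\mathcal S(x)=\{i: x_i>0\}$ and $\mathsf s(x)=|\mathcal S(x)|$. Let $\nu=\bigotimes_{i=1}^d\big(\delta_0+\mathrm{Leb}|_{(0,\infty)}\big)$, and use the convention $\ln 0=-\infty$. (a) The law of $(X^{(1)},\dots,X^{(N)})$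 is absolutely continuous with respect to $\nu^{\otimes N}$. Let the likelihood $\mathrm L(\mathcal X)$ of a data set $\mathcal X=(x^{(1)},\dots,x^{(N)})$ be its density with respect to $\nu^{\otimes N}$. Then for $\nu^{\otimes N}$-almost every $\mathcal X$ $$\ln \mathrm L(\mathcal X)=\sum_{t=1}^N\Bigg\{\ln\Bigg[\frac{\partial^{\,\mathsf s(x)}C(u_1,\dots,u_d)}{\prod_{i\in\mathcal S(x)}\partial u_i}\Bigg]_{u_i=F_i(x_i;p_i)}+\sum_{i\in\mathcal S(x)}\ln\big(p_i\,\psi_i(x_i)\big)\Bigg\}_{x=x^{(t)}},$$ where the mixed partial derivative is an iterated partial derivative taken in any order (and is $C$ itself if $\mathcal S(x)=\varnothing$); a term in which $\psi_i(x_i)=0$ for some $i\in\mathcal S(x)$ is read as $-\infty$. For almost every $\mathcal X$, for each $t$ with $\psi_i(x_i^{(t)})>0$ for all $i\in\mathcal S(x^{(t)})$, these iterated derivatives exist and are nonnegative. (b) Suppose moreover that all $\psi_i$ are continuous on $(0,\infty)$. Then, for every data set $\mathcal X$ in $([0,\infty)^d)^N$ with $\psi_i(x^{(t)}_i)>0$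 for all $t$ and all $i\in\mathcal S(x^{(t)})$, the right-hand side above also equals $$\sum_{t=1}^N\ln\Bigg[\frac{\partial^{\,\mathsf s(x)}}{\prod_{i\in\mathcal S(x)}\partial x_i}\,\mathbb P\Big(X^{(t)}_i\le x_i\ \forall i\in\mathcal S(x),\ X^{(t)}_j=0\ \forall j\notin\mathcal S(x)\Big)\Bigg]_{x=x^{(t)}},$$ where the iterated derivatives are taken in the same order on both sides; for each $t$, the derivative on one side exists if and only if the one on the other side does, and the equality is asserted whenever they exist. -/

import Mathlib

open MeasureTheory ProbabilityTheory Topology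

noncomputable section

namespace CombBernoulli

/-- A severity density: a probability density on `(0, ∞)`. Its values outside `(0, ∞)` are
irrelevant. -/
structure IsSeverityDensity (ψ : ℝ → ℝ) : Prop where
  nonneg : ∀ x, 0 < x → 0 ≤ ψ x
  integrable : IntegrableOn ψ (Set.Ioi 0)
  integral_eq_one : ∫ x in Set.Ioi 0, ψ x = 1

/-- The severity cdf `Ψ(x) = ∫_0^x ψ` for `x > 0` (and `0` for `x ≤ 0`). -/
def severityCdf (ψ : ℝ → ℝ) (x : ℝ) : ℝ := ∫ y in Set.Ioc 0 x, ψ y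

/-- The marginal cdf `F(x; p) = (1 - p) 1_{x ≥ 0} + p Ψ(x) 1_{x > 0}`. -/
def marginalCdf (p : ℝ) (ψ : ℝ → ℝ) (x : ℝ) : ℝ :=
  (1 - p) * (if 0 ≤ x then 1 else 0) + p * severityCdf ψ x * (if 0 < x then 1 else 0)

/-- The vector `u = (F_1(x_1; p_1), …, F_d(x_d; p_d))`. -/
def cdfVec {d : ℕ} (p : Fin d → ℝ) (ψ : Fin d → ℝ → ℝ) (x : Fin d → ℝ) : Fin d → ℝ :=
  fun i => marginalCdf (p i) (ψ i) (x i)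

/-- `C` is, on the cube `[0,1]^d`, an absolutely continuous copula: the distribution function of a
probability measure that is absolutely continuous with respect to Lebesgue measure and all of whose
one-dimensional margins are uniform on `[0,1]`. The values of `C` off the cube are irrelevant. -/
def IsAbsContCopula {d : ℕ} (C : (Fin d → ℝ) → ℝ) : Prop :=
  ∃ κ : Measure (Fin d → ℝ), IsProbabilityMeasure κ ∧ κ ≪ volume ∧
    (∀ i, κ.map (fun u => u i) = volume.restrict (Set.Icc (0 : ℝ) 1)) ∧
    ∀ u ∈ Set.Icc (0 : Fin d → ℝ) 1, C u = κ.real (Set.Iic u)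

/-- `X` is a Comb-Bernoulli time series of length `N`: independent random vectors
`X_0, …, X_{N-1}`, each with joint cdf `C(F_1(x_1; p_1), …, F_d(x_d; p_d))`. -/
structure IsCombBernoulliSeries {d N : ℕ} {Ω : Type*} [MeasurableSpace Ω]
    (C : (Fin d → ℝ) → ℝ) (p : Fin d → ℝ) (ψ : Fin d → ℝ → ℝ)
    (P : Measure Ω) (X : Fin N → Ω → Fin d → ℝ) : Prop where
  measurable : ∀ t, Measurable (X t)
  indep : iIndepFun X P
  cdf_eq : ∀ t x, P.real {ω | ∀ i, X t ω i ≤ x i} = C (cdfVec p ψ x)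

/-- The active set `S(x)`: the indices of the positive components of `x`. -/
def activeSet {d : ℕ} (x : Fin d → ℝ) : Finset (Fin d) := Finset.univ.filter fun i => 0 < x i

/-- The natural dominating measure of the model on `ℝ^d`: the `d`-fold product of
(unit atom at `0`) + (Lebesgue measure on `(0, ∞)`). -/
def refMeasure (d : ℕ) : Measure (Fin d → ℝ) :=
  Measure.pi fun _ => Measure.dirac 0 + volume.restrict (Set.Ioi 0)

/-- The dominating measure for a time series of `N` observations. -/
def seriesRefMeasure (N d : ℕ) : Measure (Fin N → Fin d → ℝ) :=
  Measure.pi fun _ => refMeasure d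

/-- The joint law of the whole time series. -/
def seriesLaw {d N : ℕ} {Ω : Type*} [MeasurableSpace Ω]
    (P : Measure Ω) (X : Fin N → Ω → Fin d → ℝ) : Measure (Fin N → Fin d → ℝ) :=
  P.map fun ω t => X t ω

/-- The likelihood of the data set `x`: the density of the law of the time series with respect to
the dominating measure. -/
def likelihood {d N : ℕ} {Ω : Type*} [MeasurableSpace Ω]
    (P : Measure Ω) (X : Fin N → Ω → Fin d → ℝ) : (Fin N → Fin d → ℝ) → ENNReal :=
  (seriesLaw P X).rnDeriv (seriesRefMeasure N d)

/-- The log-likelihood, with `ln 0 = -∞`. -/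
def logLikelihood {d N : ℕ} {Ω : Type*} [MeasurableSpace Ω]
    (P : Measure Ω) (X : Fin N → Ω → Fin d → ℝ) (x : Fin N → Fin d → ℝ) : EReal :=
  ENNReal.log (likelihood P X x)

/-- The logarithm of a nonnegative real, with `ln 0 = -∞`. -/
def eln (r : ℝ) : EReal := ENNReal.log (ENNReal.ofReal r)

/-- The iterated partial derivative `∂/∂u_{i₁} ⋯ ∂/∂u_{iₖ} g` for the list `[i₁, …, iₖ]` (the last
entry is differentiated first). For the empty list it is `g`. -/
def mixedPartial {d : ℕ} (g : (Fin d → ℝ) → ℝ) : List (Fin d) → (Fin d → ℝ) → ℝ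
  | [], u => g u
  | i :: l, u => deriv (fun s => mixedPartial g l (Function.update u i s)) (u i)

/-- The iterated partial derivative `∂/∂u_{i₁} ⋯ ∂/∂u_{iₖ} g` really exists at `u`: the inner one
exists at all points near `u` on the line in direction `i₁`, and is differentiable along it. -/
def HasMixedPartial {d : ℕ} (g : (Fin d → ℝ) → ℝ) : List (Fin d) → (Fin d → ℝ) → Prop
  | [], _ => True
  | i :: l, u => (∀ᶠ s in 𝓝 (u i), HasMixedPartial g l (Function.update u i s)) ∧
      DifferentiableAt ℝ (fun s => mixedPartial g l (Function.update u i s)) (u i)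

/-- The list `l` enumerates the finite set `I` (an order of differentiation). -/
def IsEnumeration {d : ℕ} (l : List (Fin d)) (I : Finset (Fin d)) : Prop :=
  l.Nodup ∧ l.toFinset = I

/-- `P(X_i ≤ x_i for i ∈ I, X_j = 0 for j ∉ I)` as a function of `x`. -/
def activeProb {d : ℕ} {Ω : Type*} [MeasurableSpace Ω] (P : Measure Ω) (Y : Ω → Fin d → ℝ)
    (I : Finset (Fin d)) (x : Fin d → ℝ) : ℝ :=
  P.real {ω | (∀ i ∈ I, Y ω i ≤ x i) ∧ ∀ j ∉ I, Y ω j = 0}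

end CombBernoulli

end

noncomputable section

namespace CombBernoulli

open scoped ENNReal

/-! Let `c` be the density of the copula on the unit cube. Differentiating `C` in the coordinates of
`A` should give, at the point with coordinates `u` in `A` and `w` elsewhere, the integral of `c
(u_A, v)` over `v ≤ w` in the other coordinates; this is `sliceMass c A u w`. The difficulty is that
the likelihood evaluates the derivative at `w_j = F_j(0) = 1 - p_j` for inactive `j`, a null set of
points of the cube. Hence a statement for almost every `u` must hold for every `w` simultaneously.
Lebesgue differentiation gives it for the countably many rational `w`; since `c ≥ 0`, increments are
monotone in `w`, and since slice masses are continuous in `w`, sandwiching between rational points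
gives all `w` (`hasDerivAt_of_forall_rat`, `ae_hasDerivAt_sliceMass`). Induction on the order of
differentiation then yields `ae_mixedPartial_eq_sliceMass`.

For the law of one observation, attach to `y` an auxiliary uniform vector `v` and replace the active
coordinates of `v` by `F_i(y_i)`. With weight `p_i ψ_i(y_i)` in active and `1_{v_i ≤ 1 - p_i}` in
inactive coordinates, this carries the reference measure to the uniform distribution on the cube
(`lintegral_liftWeight_mul`). Truncating at `y ≤ x` therefore gives the mass `C(F(x))`, and
integrating out `v` exhibits the density as `∏ p_i ψ_i(y_i)` times a slice mass
(`obsDensity_eq_sliceMass`). The same change of variables, with strictly positive weights, moves the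
exceptional null set from the cube to the data space (`ae_forall_liftVec`). Independence multiplies
the densities.

Part (b) is a chain rule, one coordinate at a time: for continuous `ψ_i`, each `F_i` is locally
invertible with differentiable inverse where `ψ_i > 0`, so existence of derivatives passes in both
directions (`mixedPartial_comp_cdfVec`). -/

/-! ### Product densities and uniqueness of measures with a given distribution function. -/

theorem lintegral_fin_prod {n : ℕ} {E : Type*} [MeasurableSpace E]
    (μ : Fin n → Measure E) [∀ i, SigmaFinite (μ i)] {f : Fin n → E → ℝ≥0∞}
    (hf : ∀ i, Measurable (f i)) :
    ∫⁻ x, ∏ i, f i (x i) ∂(Measure.pi μ) = ∏ i, ∫⁻ x, f i x ∂(μ i) := by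
  induction n with
  | zero => simp [Measure.pi_empty_univ]
  | succ n ih =>
    have hm : Measurable fun x : Fin n → E => ∏ i : Fin n, f i.succ (x i) :=
      Finset.measurable_prod _ fun i _ => (hf _).comp (measurable_pi_apply i)
    have hmp := measurePreserving_piFinSuccAbove μ 0
    have hcomp := hmp.lintegral_comp (f := fun q => f 0 q.1 * ∏ i : Fin n, f i.succ (q.2 i))
      (((hf 0).comp measurable_fst).mul (hm.comp measurable_snd))
    rw [lintegral_prod_mul (hf 0).aemeasurable hm.aemeasurable, ih _ fun i => hf i.succ] at hcomp
    rw [Fin.prod_univ_succ]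
    refine Eq.trans (lintegral_congr fun x => ?_) hcomp
    rw [Fin.prod_univ_succ]
    rfl

theorem pi_withDensity {n : ℕ} {E : Type*} [MeasurableSpace E]
    (μ : Fin n → Measure E) [∀ i, SigmaFinite (μ i)] {f : Fin n → E → ℝ≥0∞}
    (hf : ∀ i, Measurable (f i)) [∀ i, SigmaFinite ((μ i).withDensity (f i))] :
    Measure.pi (fun i => (μ i).withDensity (f i)) =
      (Measure.pi μ).withDensity fun x => ∏ i, f i (x i) := by
  refine Measure.pi_eq fun s hs => ?_
  rw [withDensity_apply _ (MeasurableSet.univ_pi hs), ← lintegral_indicator (MeasurableSet.univ_pi hs)]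
  have : ((Set.univ.pi s).indicator fun x : Fin n → E => ∏ i, f i (x i)) =
      fun x => ∏ i, (s i).indicator (f i) (x i) := by
    classical
    funext x
    by_cases hx : x ∈ Set.univ.pi s
    · rw [Set.indicator_of_mem hx]
      exact Finset.prod_congr rfl fun i _ => (Set.indicator_of_mem (hx i trivial) _).symm
    · rw [Set.indicator_of_notMem hx]
      simp only [Set.mem_univ_pi, not_forall] at hx
      obtain ⟨i, hi⟩ := hx
      exact (Finset.prod_eq_zero (Finset.mem_univ i) (Set.indicator_of_notMem hi _)).symm
  rw [this, lintegral_fin_prod μ fun i => (hf i).indicator (hs i)]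
  refine Finset.prod_congr rfl fun i _ => ?_
  rw [withDensity_apply _ (hs i), lintegral_indicator (hs i)]

theorem measure_ext_of_Iic {d : ℕ} (μ ν : Measure (Fin d → ℝ)) [IsFiniteMeasure μ]
    (h : ∀ x, μ (Set.Iic x) = ν (Set.Iic x)) : μ = ν := by
  have hC : ∀ i : Fin d, MeasurableSpace.generateFrom (Set.range (Set.Iic : ℝ → Set ℝ)) =
      (inferInstance : MeasurableSpace ℝ) := fun _ => by
    rw [← borel_eq_generateFrom_Iic]; exact (BorelSpace.measurable_eq).symm
  have hS : ∀ i : Fin d, IsCountablySpanning (Set.range (Set.Iic : ℝ → Set ℝ)) := fun _ =>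
    ⟨fun n => Set.Iic (n : ℝ), fun n => ⟨_, rfl⟩, by
      refine Set.eq_univ_of_forall fun x => ?_
      obtain ⟨n, hn⟩ := exists_nat_ge x
      exact Set.mem_iUnion.2 ⟨n, hn⟩⟩
  have hmem : ∀ s ∈ Set.pi Set.univ '' Set.pi Set.univ
      (fun _ : Fin d => Set.range (Set.Iic : ℝ → Set ℝ)), ∃ x, s = Set.Iic x := by
    rintro _ ⟨t, ht, rfl⟩
    choose x hx using fun i => ht i trivial
    refine ⟨x, ?_⟩
    rw [← Set.pi_univ_Iic]
    exact congrArg _ (funext fun i => (hx i).symm)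
  -- The orthants below `(n, …, n)` exhaust the space, so the total masses agree and `ν` need not be
  -- assumed finite.
  have huniv : μ Set.univ = ν Set.univ := by
    have hmono : Monotone fun n : ℕ => Set.Iic (fun _ : Fin d => (n : ℝ)) := fun m n hmn =>
      Set.Iic_subset_Iic.2 fun _ => by simpa using hmn
    have hU : ⋃ n : ℕ, Set.Iic (fun _ : Fin d => (n : ℝ)) = Set.univ := by
      refine Set.eq_univ_of_forall fun x => ?_
      obtain ⟨n, hn⟩ := exists_nat_ge (∑ i, |x i|)
      exact Set.mem_iUnion.2 ⟨n, fun i => (le_abs_self _).trans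
        ((Finset.single_le_sum (f := fun i => |x i|) (fun _ _ => abs_nonneg _)
          (Finset.mem_univ i)).trans hn)⟩
    rw [← hU, hmono.measure_iUnion, hmono.measure_iUnion]
    simp only [h]
  refine ext_of_generate_finite _
    (generateFrom_eq_pi hC hS).symm (IsPiSystem.pi fun _ => isPiSystem_Iic) ?_ huniv
  intro s hs
  obtain ⟨x, rfl⟩ := hmem s hs
  exact h x

/-! ### The uniform measure on the cube and Fubini by resampling coordinates. -/

/-- The uniform distribution on the unit interval. -/
def unif : Measure ℝ := volume.restrict (Set.Icc 0 1)

instance : IsProbabilityMeasure unif := ⟨by simp [unif]⟩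

/-- The uniform distribution on the unit cube. -/
def cubeMeasure (d : ℕ) : Measure (Fin d → ℝ) := Measure.pi fun _ => unif

instance (d : ℕ) : IsProbabilityMeasure (cubeMeasure d) := by
  unfold cubeMeasure; infer_instance

theorem cubeMeasure_eq_restrict (d : ℕ) :
    cubeMeasure d = volume.restrict (Set.Icc 0 1) := by
  rw [cubeMeasure, ← Set.pi_univ_Icc, volume_pi, Measure.restrict_pi_pi]
  rfl

theorem measurable_piecewise_prod {d : ℕ} (A : Finset (Fin d)) :
    Measurable fun q : (Fin d → ℝ) × (Fin d → ℝ) => A.piecewise q.1 q.2 := by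
  refine measurable_pi_lambda _ fun i => ?_
  by_cases hi : i ∈ A
  · simp only [Finset.piecewise_eq_of_mem _ _ _ hi]; fun_prop
  · simp only [Finset.piecewise_eq_of_notMem _ _ _ hi]; fun_prop

theorem measurable_update_prod {d : ℕ} (i : Fin d) :
    Measurable fun q : (Fin d → ℝ) × ℝ => Function.update q.1 i q.2 := by
  refine measurable_pi_lambda _ fun j => ?_
  by_cases hj : j = i
  · subst hj; simp only [Function.update_self]; fun_prop
  · simp only [Function.update_of_ne hj]; fun_prop

/-- Splicing two independent uniform vectors gives a uniform vector. This is Fubini for the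
splitting into `A` and its complement without splitting the index type: the superfluous coordinates
integrate to 1. -/
theorem map_piecewise_cubeMeasure {d : ℕ} (A : Finset (Fin d)) :
    ((cubeMeasure d).prod (cubeMeasure d)).map (fun q => A.piecewise q.1 q.2) = cubeMeasure d := by
  refine (Measure.pi_eq fun s hs => ?_).symm
  rw [Measure.map_apply (measurable_piecewise_prod A) (MeasurableSet.univ_pi hs)]
  have : (fun q : (Fin d → ℝ) × (Fin d → ℝ) => A.piecewise q.1 q.2) ⁻¹' Set.univ.pi s =
      (Set.univ.pi (A.piecewise s fun _ => Set.univ)) ×ˢ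
        (Set.univ.pi (A.piecewise (fun _ => Set.univ) s)) := by
    ext q
    simp only [Set.mem_preimage, Set.mem_univ_pi, Set.mem_prod, ← forall_and]
    refine forall_congr' fun i => ?_
    by_cases hi : i ∈ A <;> simp [hi]
  rw [this, Measure.prod_prod, cubeMeasure, Measure.pi_pi, Measure.pi_pi, ← Finset.prod_mul_distrib]
  refine Finset.prod_congr rfl fun i _ => ?_
  by_cases hi : i ∈ A <;> simp [hi]

theorem map_update_cubeMeasure {d : ℕ} (i : Fin d) :
    ((cubeMeasure d).prod unif).map (fun q => Function.update q.1 i q.2) = cubeMeasure d := by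
  refine (Measure.pi_eq fun s hs => ?_).symm
  rw [Measure.map_apply (measurable_update_prod i) (MeasurableSet.univ_pi hs)]
  have : (fun q : (Fin d → ℝ) × ℝ => Function.update q.1 i q.2) ⁻¹' Set.univ.pi s =
      (Set.univ.pi (Function.update s i Set.univ)) ×ˢ s i := by
    ext q
    simp only [Set.mem_preimage, Set.mem_univ_pi, Set.mem_prod]
    constructor
    · intro h
      refine ⟨fun j => ?_, by simpa using h i⟩
      by_cases hj : j = i
      · subst hj; simp
      · simpa [hj] using h j
    · rintro ⟨h, h'⟩ j
      by_cases hj : j = i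
      · subst hj; simpa using h'
      · simpa [hj] using h j
  rw [this, Measure.prod_prod, cubeMeasure, Measure.pi_pi,
    ← Finset.mul_prod_erase _ _ (Finset.mem_univ i), ← Finset.mul_prod_erase _ _ (Finset.mem_univ i)]
  rw [Function.update_self, measure_univ, one_mul, mul_comm]
  congr 1
  refine Finset.prod_congr rfl fun j hj => ?_
  rw [Function.update_of_ne (Finset.ne_of_mem_erase hj)]

theorem lintegral_update_cubeMeasure {d : ℕ} (i : Fin d) {g : (Fin d → ℝ) → ℝ≥0∞}
    (hg : Measurable g) :
    ∫⁻ u, ∫⁻ r, g (Function.update u i r) ∂unif ∂(cubeMeasure d) = ∫⁻ u, g u ∂(cubeMeasure d) := by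
  conv_rhs => rw [← map_update_cubeMeasure i, lintegral_map hg (measurable_update_prod i)]
  rw [lintegral_prod]
  exact (hg.comp (measurable_update_prod i)).aemeasurable

theorem lintegral_update_cubeMeasure' {d : ℕ} (i : Fin d) {g : (Fin d → ℝ) → ℝ≥0∞}
    (hg : Measurable g) :
    ∫⁻ r, ∫⁻ u, g (Function.update u i r) ∂(cubeMeasure d) ∂unif = ∫⁻ u, g u ∂(cubeMeasure d) := by
  rw [← lintegral_update_cubeMeasure i hg]
  exact lintegral_lintegral_swap
    ((hg.comp (measurable_update_prod i)).comp measurable_swap).aemeasurable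

theorem ae_of_ae_ae_update {d : ℕ} (i : Fin d) {E : Set (Fin d → ℝ)} (hE : MeasurableSet E)
    (h : ∀ᵐ u ∂(cubeMeasure d), ∀ᵐ r ∂unif, Function.update u i r ∈ E) :
    ∀ᵐ u ∂(cubeMeasure d), u ∈ E := by
  rw [← map_update_cubeMeasure i]
  refine (ae_map_iff (measurable_update_prod i).aemeasurable hE).2 ?_
  exact (Measure.ae_prod_iff_ae_ae (measurable_update_prod i hE)).2 h

theorem ae_cubeMeasure_mem_Ioo {d : ℕ} :
    ∀ᵐ u ∂(cubeMeasure d), ∀ i, u i ∈ Set.Ioo (0 : ℝ) 1 := by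
  refine ae_all_iff.2 fun i => ?_
  refine Measure.tendsto_eval_ae_ae (i := i) ?_
  change ∀ᵐ r ∂unif, r ∈ Set.Ioo (0 : ℝ) 1
  rw [unif, ← Measure.restrict_congr_set Ioo_ae_eq_Icc]
  exact ae_restrict_mem measurableSet_Ioo

/-! ### Lebesgue differentiation along one coordinate, with parameters. -/

/-- The mass that `h` puts on `(-∞, t]` with respect to the uniform distribution. -/
def cumul (h : ℝ → ℝ≥0∞) (t : ℝ) : ℝ := (∫⁻ r in Set.Iic t, h r ∂unif).toReal

/-- Extending `h` by zero outside the unit interval makes `cumul h` an ordinary primitive up to a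
constant, which is irrelevant for continuity and derivatives. -/
theorem exists_cumul_eq {h : ℝ → ℝ≥0∞} (hm : Measurable h) (hfin : ∫⁻ r, h r ∂unif ≠ ∞) :
    ∃ (f : ℝ → ℝ) (a : ℝ), Integrable f ∧ (∀ r ∈ Set.Icc (0 : ℝ) 1, f r = (h r).toReal) ∧
      ∀ t, cumul h t = a + ∫ r in (0 : ℝ)..t, f r := by
  have hI : Integrable (fun r => (h r).toReal) unif := integrable_toReal_of_lintegral_ne_top
    hm.aemeasurable hfin
  have hF : Integrable ((Set.Icc (0 : ℝ) 1).indicator fun r => (h r).toReal) :=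
    (integrable_indicator_iff measurableSet_Icc).2 hI
  refine ⟨_, ∫ r in Set.Iic (0 : ℝ), (Set.Icc (0 : ℝ) 1).indicator (fun r => (h r).toReal) r, hF,
    fun r hr => Set.indicator_of_mem hr _, fun t => ?_⟩
  rw [← intervalIntegral.integral_Iic_sub_Iic hF.integrableOn hF.integrableOn, add_sub_cancel,
    cumul, ← integral_toReal hm.aemeasurable (ae_restrict_of_ae (ae_lt_top hm hfin)),
    integral_indicator measurableSet_Icc, unif, Measure.restrict_restrict measurableSet_Iic,
    Measure.restrict_restrict measurableSet_Icc, Set.inter_comm]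

theorem continuous_cumul {h : ℝ → ℝ≥0∞} (hm : Measurable h) (hfin : ∫⁻ r, h r ∂unif ≠ ∞) :
    Continuous (cumul h) := by
  obtain ⟨f, a, hf, -, hc⟩ := exists_cumul_eq hm hfin
  rw [show cumul h = fun t => a + ∫ r in (0 : ℝ)..t, f r from funext hc]
  exact continuous_const.add (intervalIntegral.continuous_primitive
    (fun _ _ => hf.intervalIntegrable) 0)

theorem ae_hasDerivAt_cumul {h : ℝ → ℝ≥0∞} (hm : Measurable h) (hfin : ∫⁻ r, h r ∂unif ≠ ∞) :
    ∀ᵐ s ∂unif, HasDerivAt (cumul h) (h s).toReal s := by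
  obtain ⟨f, a, hf, hfh, hc⟩ := exists_cumul_eq hm hfin
  rw [show cumul h = fun t => a + ∫ r in (0 : ℝ)..t, f r from funext hc, unif,
    ae_restrict_iff' measurableSet_Icc]
  filter_upwards [LocallyIntegrable.ae_hasDerivAt_integral hf.locallyIntegrable] with s hs hmem
  rw [← hfh s hmem]
  exact (hs 0).const_add a

theorem cumul_sub_le {h h' : ℝ → ℝ≥0∞} (hle : ∀ r, h r ≤ h' r) (hfin : ∫⁻ r, h' r ∂unif ≠ ∞)
    {s t : ℝ} (hst : s ≤ t) : cumul h t - cumul h s ≤ cumul h' t - cumul h' s := by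
  have key : ∀ k : ℝ → ℝ≥0∞, (∫⁻ r, k r ∂unif ≠ ∞) →
      cumul k t = cumul k s + (∫⁻ r in Set.Ioc s t, k r ∂unif).toReal := fun k hk => by
    have hf : ∀ S : Set ℝ, ∫⁻ r in S, k r ∂unif ≠ ∞ := fun S =>
      ne_top_of_le_ne_top hk (setLIntegral_le_lintegral S k)
    rw [cumul, cumul, ← ENNReal.toReal_add (hf _) (hf _), ← lintegral_union measurableSet_Ioc
      (Set.Iic_disjoint_Ioc le_rfl), Set.Iic_union_Ioc_eq_Iic hst]
  have hfin' : ∫⁻ r, h r ∂unif ≠ ∞ := ne_top_of_le_ne_top hfin (lintegral_mono hle)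
  rw [key h hfin', key h' hfin, add_sub_cancel_left, add_sub_cancel_left]
  exact ENNReal.toReal_mono (ne_top_of_le_ne_top hfin (setLIntegral_le_lintegral _ _))
    (lintegral_mono hle)

/-- With only countable quantifiers left, the set of points of differentiability becomes measurable,
as Fubini requires. Rational increments suffice because the estimate is a closed condition on the
increment. -/
theorem hasDerivAt_iff_forall_rat {φ : ℝ → ℝ} (hφ : Continuous φ) (a s : ℝ) :
    HasDerivAt φ a s ↔ ∀ n : ℕ, ∃ m : ℕ, ∀ q : ℚ, |(q : ℝ)| < 1 / ((m : ℝ) + 1) →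
      |φ (s + q) - φ s - q * a| ≤ 1 / ((n : ℝ) + 1) * |(q : ℝ)| := by
  rw [hasDerivAt_iff_isLittleO_nhds_zero, Asymptotics.isLittleO_iff]
  simp only [Real.norm_eq_abs, smul_eq_mul]
  constructor
  · intro h n
    obtain ⟨δ, hδ, hd⟩ := Metric.eventually_nhds_iff.1 (h (Nat.one_div_pos_of_nat (n := n)))
    obtain ⟨m, hm⟩ := exists_nat_one_div_lt hδ
    exact ⟨m, fun q hq => hd (by rw [Real.dist_eq, sub_zero]; exact hq.trans hm)⟩
  · intro h ε hε
    obtain ⟨n, hn⟩ := exists_nat_one_div_lt hε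
    obtain ⟨m, hm⟩ := h n
    have hpos : (0 : ℝ) < 1 / ((m : ℝ) + 1) := Nat.one_div_pos_of_nat
    refine Metric.eventually_nhds_iff.2 ⟨_, hpos, fun x hx => ?_⟩
    rw [Real.dist_eq, sub_zero] at hx
    have hcl : IsClosed {x : ℝ | |φ (s + x) - φ s - x * a| ≤ 1 / ((n : ℝ) + 1) * |x|} :=
      isClosed_le (by fun_prop) (by fun_prop)
    have hopen : IsOpen {x : ℝ | |x| < 1 / ((m : ℝ) + 1)} :=
      isOpen_lt continuous_abs continuous_const
    have hx' : x ∈ closure ({x : ℝ | |x| < 1 / ((m : ℝ) + 1)} ∩ Set.range ((↑) : ℚ → ℝ)) :=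
      Dense.open_subset_closure_inter (Rat.denseRange_cast (𝕜 := ℝ)) hopen hx
    have : x ∈ {x : ℝ | |φ (s + x) - φ s - x * a| ≤ 1 / ((n : ℝ) + 1) * |x|} := by
      refine hcl.closure_subset_iff.2 ?_ hx'
      rintro _ ⟨hq, q, rfl⟩
      exact hm q hq
    exact this.trans (by gcongr)

theorem measurable_cumul_update {d : ℕ} (i : Fin d) {g : (Fin d → ℝ) → ℝ≥0∞} (hg : Measurable g)
    (τ : (Fin d → ℝ) → ℝ) (hτ : Measurable τ) :
    Measurable fun u => cumul (fun r => g (Function.update u i r)) (τ u) := by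
  unfold cumul
  refine ENNReal.measurable_toReal.comp ?_
  have : ∀ u, ∫⁻ r in Set.Iic (τ u), g (Function.update u i r) ∂unif =
      ∫⁻ r, {q : (Fin d → ℝ) × ℝ | q.2 ≤ τ q.1}.indicator
        (fun q => g (Function.update q.1 i q.2)) (u, r) ∂unif := fun u => by
    rw [← lintegral_indicator measurableSet_Iic]
    rfl
  simp only [this]
  refine Measurable.lintegral_prod_right' (f := {q : (Fin d → ℝ) × ℝ | q.2 ≤ τ q.1}.indicator
        (fun q => g (Function.update q.1 i q.2))) ?_
  exact (hg.comp (measurable_update_prod i)).indicator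
    (measurableSet_le measurable_snd (hτ.comp measurable_fst))

/-- Lebesgue's differentiation theorem in one coordinate of the cube. -/
theorem ae_hasDerivAt_cumul_update {d : ℕ} (i : Fin d) {g : (Fin d → ℝ) → ℝ≥0∞}
    (hg : Measurable g) (hfin : ∫⁻ u, g u ∂(cubeMeasure d) ≠ ∞) :
    ∀ᵐ u ∂(cubeMeasure d), ∫⁻ r, g (Function.update u i r) ∂unif ≠ ∞ ∧
      HasDerivAt (cumul fun r => g (Function.update u i r)) (g u).toReal (u i) := by
  have hmeas : ∀ u, Measurable fun r => g (Function.update u i r) := fun u =>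
    hg.comp (measurable_update u)
  have hI : Measurable fun u => ∫⁻ r, g (Function.update u i r) ∂unif :=
    (hg.comp (measurable_update_prod i)).lintegral_prod_right'
  have hae : ∀ᵐ u ∂(cubeMeasure d), ∫⁻ r, g (Function.update u i r) ∂unif ≠ ∞ := by
    rw [← lintegral_update_cubeMeasure i hg] at hfin
    filter_upwards [ae_lt_top hI hfin] with u hu using hu.ne
  refine ae_of_ae_ae_update i (E := {u | ∫⁻ r, g (Function.update u i r) ∂unif ≠ ∞ ∧
      HasDerivAt (cumul fun r => g (Function.update u i r)) (g u).toReal (u i)}) ?_ ?_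
  -- The finiteness condition is part of the set because it makes `cumul` continuous, which the
  -- rational criterion needs.
  · have : {u | ∫⁻ r, g (Function.update u i r) ∂unif ≠ ∞ ∧
        HasDerivAt (cumul fun r => g (Function.update u i r)) (g u).toReal (u i)} =
        {u | ∫⁻ r, g (Function.update u i r) ∂unif ≠ ∞} ∩
        ⋂ n : ℕ, ⋃ m : ℕ, ⋂ q : ℚ, {u | |(q : ℝ)| < 1 / ((m : ℝ) + 1) →
          |cumul (fun r => g (Function.update u i r)) (u i + q) -
            cumul (fun r => g (Function.update u i r)) (u i) - q * (g u).toReal|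
            ≤ 1 / ((n : ℝ) + 1) * |(q : ℝ)|} := by
      ext u
      simp only [Set.mem_ofPred_eq, Set.mem_inter_iff, Set.mem_iInter, Set.mem_iUnion]
      exact and_congr_right fun hu =>
        hasDerivAt_iff_forall_rat (continuous_cumul (hmeas u) hu) _ _
    rw [this]
    refine (hI (measurableSet_singleton ∞).compl).inter ?_
    refine MeasurableSet.iInter fun n => MeasurableSet.iUnion fun m => MeasurableSet.iInter fun q => ?_
    refine MeasurableSet.imp (MeasurableSet.const _) (measurableSet_le ?_ measurable_const)
    have h1 := measurable_cumul_update i hg (fun u => u i + q) (by fun_prop)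
    have h2 := measurable_cumul_update i hg (fun u => u i) (by fun_prop)
    have h3 := hg.ennreal_toReal
    exact ((h1.sub h2).sub (h3.const_mul _)).abs
  · filter_upwards [hae] with u hu
    filter_upwards [ae_hasDerivAt_cumul (hmeas u) hu] with s hs
    simp only [Function.update_idem, Function.update_self]
    exact ⟨hu, hs⟩

theorem exists_rat_near {d : ℕ} (w : Fin d → ℝ) {δ : ℝ} (hδ : 0 < δ) :
    ∃ a b : Fin d → ℚ, (fun i => (a i : ℝ)) ≤ w ∧ w ≤ (fun i => (b i : ℝ)) ∧
      dist (fun i => (a i : ℝ)) w < δ ∧ dist (fun i => (b i : ℝ)) w < δ := by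
  choose a ha ha' using fun i => exists_rat_btwn (show w i - δ < w i by linarith)
  choose b hb hb' using fun i => exists_rat_btwn (show w i < w i + δ by linarith)
  refine ⟨a, b, fun i => (ha' i).le, fun i => (hb i).le, ?_, ?_⟩
  · refine (dist_pi_lt_iff hδ).2 fun i => ?_
    rw [Real.dist_eq, abs_lt]; constructor <;> linarith [ha i, ha' i]
  · refine (dist_pi_lt_iff hδ).2 fun i => ?_
    rw [Real.dist_eq, abs_lt]; constructor <;> linarith [hb i, hb' i]

/-- For rational `a ≤ w ≤ b` close to `w`, the increment of `Φ w` lies between those of `Φ a` and `Φ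
b`. Half of `ε` covers their linearization errors, the other half the deviation of `D a` and `D b`
from `D w`. -/
theorem hasDerivAt_of_forall_rat {d : ℕ} {Φ : (Fin d → ℝ) → ℝ → ℝ} {D : (Fin d → ℝ) → ℝ} {s : ℝ}
    (hD : Continuous D)
    (hmono : ∀ w w', w ≤ w' → ∀ a b, a ≤ b → Φ w b - Φ w a ≤ Φ w' b - Φ w' a)
    (hq : ∀ q : Fin d → ℚ, HasDerivAt (Φ fun i => (q i : ℝ)) (D fun i => (q i : ℝ)) s)
    (w : Fin d → ℝ) : HasDerivAt (Φ w) (D w) s := by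
  rw [hasDerivAt_iff_isLittleO_nhds_zero, Asymptotics.isLittleO_iff]
  intro ε hε
  obtain ⟨δ, hδ, hd⟩ := Metric.continuousAt_iff.1 (hD.continuousAt (x := w)) (ε / 2) (half_pos hε)
  obtain ⟨a, b, haw, hwb, had, hbd⟩ := exists_rat_near w hδ
  have ha := Asymptotics.isLittleO_iff.1 (hasDerivAt_iff_isLittleO_nhds_zero.1 (hq a)) (half_pos hε)
  have hb := Asymptotics.isLittleO_iff.1 (hasDerivAt_iff_isLittleO_nhds_zero.1 (hq b)) (half_pos hε)
  have hDa := hd had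
  have hDb := hd hbd
  rw [Real.dist_eq, abs_lt] at hDa hDb
  filter_upwards [ha, hb] with h h1 h2
  simp only [Real.norm_eq_abs, smul_eq_mul] at h1 h2 ⊢
  rw [abs_le] at h1 h2 ⊢
  rcases le_total 0 h with hh | hh
  · rw [abs_of_nonneg hh] at *
    have e1 := hmono _ _ haw s (s + h) (by linarith)
    have e2 := hmono _ _ hwb s (s + h) (by linarith)
    constructor <;> nlinarith
  · rw [abs_of_nonpos hh] at *
    have e1 := hmono _ _ haw (s + h) s (by linarith)
    have e2 := hmono _ _ hwb (s + h) s (by linarith)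
    constructor <;> nlinarith

/-! ### Sections of the copula density and the mixed partial derivatives of `C`. -/

section

/-- For a density `c` on the cube: its section at `u` in the coordinates of `A`, integrated over
`v ≤ w` in the remaining coordinates. -/
def sliceMass {d : ℕ} (c : (Fin d → ℝ) → ℝ≥0∞) (A : Finset (Fin d)) (u w : Fin d → ℝ) : ℝ≥0∞ :=
  ∫⁻ v, {v : Fin d → ℝ | ∀ i ∉ A, v i ≤ w i}.indicator (fun v => c (A.piecewise u v)) v
    ∂(cubeMeasure d)

/-- The section of `c` at `u` in the coordinates of `A`, integrated over all other coordinates. -/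
def sliceTotal {d : ℕ} (c : (Fin d → ℝ) → ℝ≥0∞) (A : Finset (Fin d)) (u : Fin d → ℝ) : ℝ≥0∞ :=
  ∫⁻ v, c (A.piecewise u v) ∂(cubeMeasure d)

variable {d : ℕ} {c : (Fin d → ℝ) → ℝ≥0∞}

theorem measurableSet_forall_notMem_le (A : Finset (Fin d)) (w : Fin d → ℝ) :
    MeasurableSet {v : Fin d → ℝ | ∀ i ∉ A, v i ≤ w i} := by
  simp only [Set.ofPred_forall]
  exact MeasurableSet.iInter fun i => MeasurableSet.iInter fun _ =>
    measurableSet_le (measurable_pi_apply i) measurable_const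

theorem measurable_slice (hc : Measurable c) (A : Finset (Fin d)) (u : Fin d → ℝ) :
    Measurable fun v => c (A.piecewise u v) :=
  hc.comp ((measurable_piecewise_prod A).comp measurable_prodMk_left)

theorem measurable_sliceMass (hc : Measurable c) (A : Finset (Fin d)) (w : Fin d → ℝ) :
    Measurable fun u => sliceMass c A u w := by
  unfold sliceMass
  refine Measurable.lintegral_prod_right' (f := {q : (Fin d → ℝ) × (Fin d → ℝ) |
    q.2 ∈ {v : Fin d → ℝ | ∀ i ∉ A, v i ≤ w i}}.indicator
      fun q => c (A.piecewise q.1 q.2)) ?_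
  exact (hc.comp (measurable_piecewise_prod A)).indicator
    (measurable_snd (measurableSet_forall_notMem_le A w))

theorem measurable_sliceTotal (hc : Measurable c) (A : Finset (Fin d)) :
    Measurable (sliceTotal c A) :=
  (hc.comp (measurable_piecewise_prod A)).lintegral_prod_right'

theorem lintegral_sliceTotal (hc : Measurable c) (A : Finset (Fin d)) :
    ∫⁻ u, sliceTotal c A u ∂(cubeMeasure d) = ∫⁻ u, c u ∂(cubeMeasure d) := by
  conv_rhs => rw [← map_piecewise_cubeMeasure A, lintegral_map hc (measurable_piecewise_prod A)]
  exact (lintegral_prod _ (hc.comp (measurable_piecewise_prod A)).aemeasurable).symm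

theorem sliceMass_le_sliceTotal (A : Finset (Fin d)) (u w : Fin d → ℝ) :
    sliceMass c A u w ≤ sliceTotal c A u :=
  lintegral_mono fun _ => Set.indicator_le_self _ _ _

theorem sliceMass_mono (A : Finset (Fin d)) (u : Fin d → ℝ) {w w' : Fin d → ℝ} (h : w ≤ w') :
    sliceMass c A u w ≤ sliceMass c A u w' :=
  lintegral_mono fun _ => Set.indicator_le_indicator_of_subset
    (fun _ hv i hi => (hv i hi).trans (h i)) (fun _ => zero_le) _

/-- Dominated convergence: the indicator of `v ≤ w'` converges as `w'` tends to `w` unless `v` lies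
on one of the null hyperplanes `v_i = w_i`. -/
theorem continuous_sliceMass (hc : Measurable c) (A : Finset (Fin d)) (u : Fin d → ℝ)
    (hfin : sliceTotal c A u ≠ ∞) : Continuous fun w => (sliceMass c A u w).toReal := by
  refine continuous_iff_continuousAt.2 fun w => ?_
  refine (ENNReal.tendsto_toReal
    (ne_top_of_le_ne_top hfin (sliceMass_le_sliceTotal A u w))).comp ?_
  refine tendsto_lintegral_filter_of_dominated_convergence (fun v => c (A.piecewise u v))
    (.of_forall fun w' => (measurable_slice hc A u).indicator (measurableSet_forall_notMem_le A w'))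
    (.of_forall fun w' => .of_forall fun v => Set.indicator_le_self _ _ _) hfin ?_
  have hne : ∀ᵐ v ∂(cubeMeasure d), ∀ i, v i ≠ w i := ae_all_iff.2 fun i => by
    have : ∀ᵐ r ∂unif, r ≠ w i := ae_restrict_of_ae (Measure.ae_ne volume (w i))
    exact (Measure.tendsto_eval_ae_ae (μ := fun _ : Fin d => unif) (i := i)).eventually this
  filter_upwards [hne] with v hv
  refine tendsto_const_nhds.congr' ?_
  have hev : ∀ᶠ w' in 𝓝 w, ∀ i, (v i ≤ w i ↔ v i ≤ w' i) := by
    refine Filter.eventually_all.2 fun i => ?_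
    have hci : Filter.Tendsto (fun w' : Fin d → ℝ => w' i) (𝓝 w) (𝓝 (w i)) :=
      (continuous_apply i).continuousAt
    rcases lt_or_gt_of_ne (hv i) with h | h
    · filter_upwards [hci.eventually (lt_mem_nhds h)] with w' hw'
      exact ⟨fun _ => hw'.le, fun _ => h.le⟩
    · filter_upwards [hci.eventually (gt_mem_nhds h)] with w' hw'
      exact ⟨fun h' => absurd h' (not_le.2 h), fun h' => absurd h' (not_le.2 hw')⟩
  filter_upwards [hev] with w' hw'
  simp only [Set.indicator, Set.mem_ofPred_eq, hw']

theorem piecewise_update_insert {A : Finset (Fin d)} {i : Fin d} (hi : i ∉ A) (u v : Fin d → ℝ)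
    (r : ℝ) : (insert i A).piecewise (Function.update u i r) v =
      A.piecewise u (Function.update v i r) := by
  funext j
  by_cases hj : j = i
  · subst hj; simp [hi]
  · by_cases hjA : j ∈ A <;> simp [hj, hjA]

theorem update_piecewise_insert {A : Finset (Fin d)} {i : Fin d} (hi : i ∉ A) (u w : Fin d → ℝ)
    (r : ℝ) : Function.update ((insert i A).piecewise u w) i r =
      A.piecewise u (Function.update w i r) := by
  funext j
  by_cases hj : j = i
  · subst hj; simp [hi]
  · by_cases hjA : j ∈ A <;> simp [hj, hjA]

/-- Fubini in coordinate `i`: the constraint `v_i ≤ t` becomes the range of the outer integral, and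
`i` joins the frozen coordinates. Differentiating in `t` thus passes from `A` to `insert i A`. -/
theorem sliceMass_update (hc : Measurable c) {A : Finset (Fin d)} {i : Fin d} (hi : i ∉ A)
    (u w : Fin d → ℝ) (t : ℝ) :
    sliceMass c A u (Function.update w i t) =
      ∫⁻ r in Set.Iic t, sliceMass c (insert i A) (Function.update u i r) w ∂unif := by
  rw [← lintegral_indicator measurableSet_Iic, sliceMass, ← lintegral_update_cubeMeasure' i
    ((measurable_slice hc A u).indicator (measurableSet_forall_notMem_le A _))]
  refine lintegral_congr fun r => ?_
  by_cases hr : r ≤ t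
  · rw [Set.indicator_of_mem (Set.mem_Iic.2 hr), sliceMass]
    refine lintegral_congr fun v => ?_
    simp only [piecewise_update_insert hi]
    have : Function.update v i r ∈ {v : Fin d → ℝ | ∀ j ∉ A, v j ≤ Function.update w i t j} ↔
        v ∈ {v : Fin d → ℝ | ∀ j ∉ insert i A, v j ≤ w j} := by
      simp only [Set.mem_ofPred_eq, Finset.mem_insert, not_or]
      constructor
      · rintro h j ⟨hj, hjA⟩
        simpa [hj] using h j hjA
      · intro h j hjA
        by_cases hj : j = i
        · subst hj; simpa using hr
        · simpa [hj] using h j ⟨hj, hjA⟩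
    simp only [Set.indicator, this]
  · rw [Set.indicator_of_notMem (by simpa using hr)]
    refine (lintegral_congr fun v => ?_).trans lintegral_zero
    refine Set.indicator_of_notMem (fun h => hr ?_) _
    simpa using h i hi

/-- The point is the order of quantifiers: one null set of `u` serves all `w`. Finiteness of
`sliceTotal`, which dominates every slice mass, gives the continuity and the monotone increments
used in the sandwich. -/
theorem ae_hasDerivAt_sliceMass (hc : Measurable c) (hfin : ∫⁻ u, c u ∂(cubeMeasure d) ≠ ∞)
    (A : Finset (Fin d)) (i : Fin d) :
    ∀ᵐ u ∂(cubeMeasure d), ∀ w,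
      HasDerivAt (cumul fun r => sliceMass c A (Function.update u i r) w)
        (sliceMass c A u w).toReal (u i) := by
  have hq : ∀ᵐ u ∂(cubeMeasure d), ∀ q : Fin d → ℚ,
      HasDerivAt (cumul fun r => sliceMass c A (Function.update u i r) fun j => (q j : ℝ))
        (sliceMass c A u fun j => (q j : ℝ)).toReal (u i) := by
    refine ae_all_iff.2 fun q => ?_
    refine (ae_hasDerivAt_cumul_update i (measurable_sliceMass hc A _) ?_).mono fun u hu => hu.2
    refine ne_top_of_le_ne_top hfin ?_
    rw [← lintegral_sliceTotal hc A]
    exact lintegral_mono fun u => sliceMass_le_sliceTotal A u _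
  have ht := ae_hasDerivAt_cumul_update i (measurable_sliceTotal hc A)
    (by rwa [lintegral_sliceTotal hc A])
  have ht' := ae_lt_top (measurable_sliceTotal hc A)
    (by rwa [lintegral_sliceTotal hc A] : ∫⁻ u, sliceTotal c A u ∂(cubeMeasure d) ≠ ∞)
  filter_upwards [hq, ht, ht'] with u hu hut hut' w
  refine hasDerivAt_of_forall_rat (Φ := fun w => cumul fun r => sliceMass c A (Function.update u i r) w)
    (D := fun w => (sliceMass c A u w).toReal) (continuous_sliceMass hc A u hut'.ne) ?_ hu w
  intro w w' hw a b hab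
  refine cumul_sub_le (fun r => sliceMass_mono A _ hw) ?_ hab
  exact ne_top_of_le_ne_top hut.1 (lintegral_mono fun r => sliceMass_le_sliceTotal A _ _)

theorem update_mem_Icc {w : Fin d → ℝ} (hw : w ∈ Set.Icc (0 : Fin d → ℝ) 1) (i : Fin d) {s : ℝ}
    (hs : s ∈ Set.Icc (0 : ℝ) 1) : Function.update w i s ∈ Set.Icc (0 : Fin d → ℝ) 1 :=
  ⟨le_update_iff.2 ⟨hs.1, fun j _ => hw.1 j⟩, update_le_iff.2 ⟨hs.2, fun j _ => hw.2 j⟩⟩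

/-- Almost every section of a distribution function on the cube has all iterated partial
derivatives, and they are the integrals of the sections of its density. -/
theorem ae_mixedPartial_eq_sliceMass {C : (Fin d → ℝ) → ℝ} (hc : Measurable c)
    (hfin : ∫⁻ u, c u ∂(cubeMeasure d) ≠ ∞)
    (hC : ∀ u ∈ Set.Icc (0 : Fin d → ℝ) 1, ∀ v, C u = (sliceMass c ∅ v u).toReal)
    (l : List (Fin d)) (hl : l.Nodup) :
    ∀ᵐ u ∂(cubeMeasure d), ∀ w ∈ Set.Icc (0 : Fin d → ℝ) 1,
      HasMixedPartial C l (l.toFinset.piecewise u w) ∧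
        mixedPartial C l (l.toFinset.piecewise u w) = (sliceMass c l.toFinset u w).toReal := by
  induction l with
  | nil =>
    refine .of_forall fun u w hw => ?_
    have h : ([] : List (Fin d)).toFinset.piecewise u w = w :=
      funext fun j => Finset.piecewise_eq_of_notMem _ _ _ (by simp)
    rw [h]
    exact ⟨trivial, hC w hw u⟩
  | cons i l ih =>
    rw [List.nodup_cons] at hl
    have hi : i ∉ l.toFinset := by simpa using hl.1
    filter_upwards [ih hl.2, ae_hasDerivAt_sliceMass hc hfin (insert i l.toFinset) i,
      ae_cubeMeasure_mem_Ioo] with u h1 h2 h3 w hw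
    rw [List.toFinset_cons]
    have hui : (insert i l.toFinset).piecewise u w i = u i := by simp
    have hIcc : ∀ᶠ s in 𝓝 (u i), s ∈ Set.Icc (0 : ℝ) 1 := Icc_mem_nhds (h3 i).1 (h3 i).2
    -- Moving along direction `i` changes only `w`, not `u` in the coordinates of `l`; the induction
    -- hypothesis, valid for all `w` in the cube, therefore applies on a whole neighbourhood.
    have hev : (fun s => mixedPartial C l
        (Function.update ((insert i l.toFinset).piecewise u w) i s)) =ᶠ[𝓝 (u i)]
        cumul fun r => sliceMass c (insert i l.toFinset) (Function.update u i r) w := by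
      filter_upwards [hIcc] with s hs
      rw [update_piecewise_insert hi, (h1 _ (update_mem_Icc hw i hs)).2, sliceMass_update hc hi]
      rfl
    have hder := (h2 w).congr_of_eventuallyEq hev
    refine ⟨⟨?_, ?_⟩, ?_⟩
    · rw [hui]
      filter_upwards [hIcc] with s hs
      rw [update_piecewise_insert hi]
      exact (h1 _ (update_mem_Icc hw i hs)).1
    · rw [hui]; exact hder.differentiableAt
    · rw [mixedPartial, hui]; exact hder.deriv

end

/-! ### The marginal distribution function and the probability integral transform. -/

section

variable {p : ℝ} {ψ : ℝ → ℝ}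

theorem severityCdf_of_nonpos {x : ℝ} (hx : x ≤ 0) : severityCdf ψ x = 0 := by
  simp [severityCdf, Set.Ioc_eq_empty (not_lt.2 hx)]

namespace IsSeverityDensity

theorem monotone_severityCdf (hψ : IsSeverityDensity ψ) : Monotone (severityCdf ψ) := by
  intro x y hxy
  refine setIntegral_mono_set (hψ.integrable.mono_set Set.Ioc_subset_Ioi_self) ?_
    (Set.Ioc_subset_Ioc_right hxy).eventuallyLE
  filter_upwards [ae_restrict_mem measurableSet_Ioc] with t ht using hψ.nonneg t ht.1

theorem severityCdf_nonneg (hψ : IsSeverityDensity ψ) (x : ℝ) : 0 ≤ severityCdf ψ x :=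
  setIntegral_nonneg measurableSet_Ioc fun t ht => hψ.nonneg t ht.1

theorem severityCdf_le_one (hψ : IsSeverityDensity ψ) (x : ℝ) : severityCdf ψ x ≤ 1 := by
  rw [← hψ.integral_eq_one]
  refine setIntegral_mono_set hψ.integrable ?_ Set.Ioc_subset_Ioi_self.eventuallyLE
  filter_upwards [ae_restrict_mem measurableSet_Ioi] with t ht using hψ.nonneg t ht

theorem continuous_severityCdf (hψ : IsSeverityDensity ψ) : Continuous (severityCdf ψ) := by
  have hI : Integrable ((Set.Ioi (0 : ℝ)).indicator ψ) :=
    (integrable_indicator_iff measurableSet_Ioi).2 hψ.integrable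
  have : severityCdf ψ = fun x => ∫ t in (0 : ℝ)..(max x 0), (Set.Ioi (0 : ℝ)).indicator ψ t := by
    funext x
    rw [intervalIntegral.integral_of_le (le_max_right _ _), severityCdf]
    have hs : Set.Ioc 0 (max x 0) = Set.Ioc 0 x := by
      ext t
      simp only [Set.mem_Ioc, le_max_iff]
      exact ⟨fun h => ⟨h.1, h.2.resolve_right (not_le.2 h.1)⟩, fun h => ⟨h.1, Or.inl h.2⟩⟩
    rw [hs]
    exact setIntegral_congr_fun measurableSet_Ioc fun t ht =>
      (Set.indicator_of_mem (s := Set.Ioi (0 : ℝ)) ht.1 ψ).symm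
  rw [this]
  exact (intervalIntegral.continuous_primitive (fun _ _ => hI.intervalIntegrable) 0).comp
    (continuous_id.max continuous_const)

end IsSeverityDensity

theorem marginalCdf_of_neg {x : ℝ} (hx : x < 0) : marginalCdf p ψ x = 0 := by
  simp [marginalCdf, not_le.2 hx, not_lt.2 hx.le]

theorem marginalCdf_of_nonneg {x : ℝ} (hx : 0 ≤ x) :
    marginalCdf p ψ x = 1 - p + p * severityCdf ψ x := by
  rcases hx.eq_or_lt with rfl | h
  · simp [marginalCdf, severityCdf_of_nonpos le_rfl]
  · simp [marginalCdf, h, h.le]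

theorem marginalCdf_zero : marginalCdf p ψ 0 = 1 - p := by simp [marginalCdf]

theorem measurable_marginalCdf (hψ : IsSeverityDensity ψ) : Measurable (marginalCdf p ψ) := by
  have := hψ.continuous_severityCdf.measurable
  unfold marginalCdf
  refine (measurable_const.mul (Measurable.ite measurableSet_Ici measurable_const
    measurable_const)).add ((measurable_const.mul this).mul (Measurable.ite measurableSet_Ioi
    measurable_const measurable_const))

theorem marginalCdf_mem_Icc (hp : p ∈ Set.Ioc (0 : ℝ) 1) (hψ : IsSeverityDensity ψ) (x : ℝ) :
    marginalCdf p ψ x ∈ Set.Icc (0 : ℝ) 1 := by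
  rcases lt_or_ge x 0 with h | h
  · rw [marginalCdf_of_neg h]; simp
  · rw [marginalCdf_of_nonneg h]
    have h0 := hψ.severityCdf_nonneg x
    have h1 := hψ.severityCdf_le_one x
    constructor <;> nlinarith [hp.1, hp.2]

theorem setLIntegral_Ioc_density (hp : 0 ≤ p) (hψ : IsSeverityDensity ψ) (x : ℝ) :
    ∫⁻ y in Set.Ioc 0 x, ENNReal.ofReal (p * ψ y) = ENNReal.ofReal (p * severityCdf ψ x) := by
  rw [severityCdf, ← integral_const_mul, ofReal_integral_eq_lintegral_ofReal]
  · exact (hψ.integrable.mono_set Set.Ioc_subset_Ioi_self).const_mul p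
  · filter_upwards [ae_restrict_mem measurableSet_Ioc] with t ht
    exact mul_nonneg hp (hψ.nonneg t ht.1)

theorem setLIntegral_Ioi_density (hp : 0 ≤ p) (hψ : IsSeverityDensity ψ) :
    ∫⁻ y in Set.Ioi 0, ENNReal.ofReal (p * ψ y) = ENNReal.ofReal p := by
  rw [← ofReal_integral_eq_lintegral_ofReal (hψ.integrable.const_mul p), integral_const_mul,
    hψ.integral_eq_one, mul_one]
  filter_upwards [ae_restrict_mem measurableSet_Ioi] with t ht
  exact mul_nonneg hp (hψ.nonneg t ht)

/-- The probability integral transform for the continuous part of the margin, up to `x`. -/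
theorem map_marginalCdf_Ioc (hp : p ∈ Set.Ioc (0 : ℝ) 1) (hψ : IsSeverityDensity ψ)
    {ρ : ℝ → ℝ≥0∞} (hρ : ρ =ᵐ[volume.restrict (Set.Ioi 0)] fun y => ENNReal.ofReal (p * ψ y))
    {x : ℝ} (hx : 0 ≤ x) :
    ((volume.restrict (Set.Ioc 0 x)).withDensity ρ).map (marginalCdf p ψ) =
      volume.restrict (Set.Ioc (1 - p) (marginalCdf p ψ x)) := by
  have hmono : MonotoneOn (marginalCdf p ψ) (Set.Ici 0) := fun a ha b hb hab => by
    rw [marginalCdf_of_nonneg ha, marginalCdf_of_nonneg hb]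
    have := mul_le_mul_of_nonneg_left (hψ.monotone_severityCdf hab) hp.1.le
    linarith
  have hcont : ContinuousOn (marginalCdf p ψ) (Set.Ici 0) := by
    have : Continuous fun y => 1 - p + p * severityCdf ψ y :=
      continuous_const.add (continuous_const.mul hψ.continuous_severityCdf)
    exact this.continuousOn.congr fun y hy => marginalCdf_of_nonneg hy
  have hρx : ρ =ᵐ[volume.restrict (Set.Ioc 0 x)] fun y => ENNReal.ofReal (p * ψ y) :=
    ae_restrict_of_ae_restrict_of_subset Set.Ioc_subset_Ioi_self hρ
  rw [withDensity_congr_ae hρx]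
  symm
  refine Measure.ext_of_Iic _ _ fun a => ?_
  have hpre : MeasurableSet (marginalCdf p ψ ⁻¹' Set.Iic a) :=
    measurable_marginalCdf hψ measurableSet_Iic
  rw [Measure.map_apply (measurable_marginalCdf hψ) measurableSet_Iic, withDensity_apply _ hpre,
    Measure.restrict_restrict hpre, Measure.restrict_apply measurableSet_Iic]
  rcases lt_or_ge a (1 - p) with ha | ha
  · have h1 : Set.Iic a ∩ Set.Ioc (1 - p) (marginalCdf p ψ x) = ∅ := by
      ext t; simp only [Set.mem_inter_iff, Set.mem_Iic, Set.mem_Ioc, Set.mem_empty_iff_false,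
        iff_false]; intro h; linarith [h.1, h.2.1]
    have h2 : marginalCdf p ψ ⁻¹' Set.Iic a ∩ Set.Ioc 0 x = ∅ := by
      ext t
      simp only [Set.mem_inter_iff, Set.mem_preimage, Set.mem_Iic, Set.mem_Ioc,
        Set.mem_empty_iff_false, iff_false]
      rintro ⟨h, h0, -⟩
      have := hmono (Set.mem_Ici.2 le_rfl) (Set.mem_Ici.2 h0.le) h0.le
      rw [marginalCdf_zero] at this
      linarith
    rw [h1, h2]; simp
  · have hScomp : IsCompact (Set.Icc 0 x ∩ marginalCdf p ψ ⁻¹' Set.Iic a) := by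
      refine isCompact_Icc.of_isClosed_subset ?_ Set.inter_subset_left
      exact (hcont.mono fun t ht => ht.1).preimage_isClosed_of_isClosed isClosed_Icc isClosed_Iic
    -- `F` may have flat pieces, so `z`, the last point of `[0, x]` where `F ≤ a`, serves as
    -- generalized inverse; `F z = min a (F x)` follows from the intermediate value theorem.
    obtain ⟨z, ⟨⟨hz0, hzx⟩, hza⟩, hz⟩ := hScomp.exists_isGreatest
      ⟨0, ⟨le_rfl, hx⟩, by simpa [marginalCdf_zero] using ha⟩
    have h2 : marginalCdf p ψ ⁻¹' Set.Iic a ∩ Set.Ioc 0 x = Set.Ioc 0 z := by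
      ext t
      constructor
      · rintro ⟨h, h0, h1⟩
        exact ⟨h0, hz ⟨⟨h0.le, h1⟩, h⟩⟩
      · rintro ⟨h0, h1⟩
        exact ⟨(hmono (Set.mem_Ici.2 h0.le) hz0 h1).trans hza, h0, h1.trans hzx⟩
    have hFz : marginalCdf p ψ z = min a (marginalCdf p ψ x) := by
      refine le_antisymm (le_min hza (hmono hz0 hx hzx)) ?_
      by_contra hlt
      rw [not_le, lt_min_iff] at hlt
      have hmem : min a (marginalCdf p ψ x) ∈ Set.Icc (marginalCdf p ψ z) (marginalCdf p ψ x) :=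
        ⟨le_min hlt.1.le hlt.2.le, min_le_right _ _⟩
      obtain ⟨t, ht, hte⟩ := intermediate_value_Icc hzx
        (hcont.mono fun t ht => hz0.trans ht.1) hmem
      have h1 := hz ⟨⟨hz0.trans ht.1, ht.2⟩, hte.le.trans (min_le_left _ _)⟩
      have h2 := hmono (hz0.trans ht.1) hz0 h1
      rw [hte] at h2
      exact absurd (lt_min hlt.1 hlt.2) (not_lt.2 h2)
    have h1 : Set.Iic a ∩ Set.Ioc (1 - p) (marginalCdf p ψ x) =
        Set.Ioc (1 - p) (marginalCdf p ψ z) := by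
      ext t; simp only [Set.mem_inter_iff, Set.mem_Iic, Set.mem_Ioc, hFz, le_min_iff]; tauto
    rw [h1, h2, setLIntegral_Ioc_density hp.1.le hψ, Real.volume_Ioc, marginalCdf_of_nonneg hz0]
    congr 1; ring

/-- The probability integral transform for the continuous part of the margin. -/
theorem map_marginalCdf_Ioi (hp : p ∈ Set.Ioc (0 : ℝ) 1) (hψ : IsSeverityDensity ψ)
    {ρ : ℝ → ℝ≥0∞} (hρ : ρ =ᵐ[volume.restrict (Set.Ioi 0)] fun y => ENNReal.ofReal (p * ψ y)) :
    ((volume.restrict (Set.Ioi 0)).withDensity ρ).map (marginalCdf p ψ) =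
      volume.restrict (Set.Ioc (1 - p) 1) := by
  have hF := measurable_marginalCdf (p := p) hψ
  have : IsFiniteMeasure ((volume.restrict (Set.Ioi 0)).withDensity ρ) := by
    rw [withDensity_congr_ae hρ]
    exact isFiniteMeasure_withDensity
      ((setLIntegral_Ioi_density hp.1.le hψ).trans_ne ENNReal.ofReal_ne_top)
  -- An inequality together with equal finite total mass `p` suffices, which avoids computing the
  -- limit of `F` at infinity.
  refine Measure.eq_of_le_of_measure_univ_eq ?_ ?_
  · refine Measure.le_iff.2 fun B hB => ?_
    have hpre := hF hB
    have hU : marginalCdf p ψ ⁻¹' B ∩ Set.Ioi 0 =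
        ⋃ n : ℕ, (marginalCdf p ψ ⁻¹' B ∩ Set.Ioc (0 : ℝ) n) := by
      rw [← Set.inter_iUnion]
      congr 1
      ext t
      simp only [Set.mem_Ioi, Set.mem_iUnion, Set.mem_Ioc]
      exact ⟨fun h => (exists_nat_ge t).imp fun n hn => ⟨h, hn⟩, fun ⟨n, h, _⟩ => h⟩
    rw [Measure.map_apply hF hB, withDensity_apply _ hpre, Measure.restrict_restrict hpre, hU,
      setLIntegral_iUnion_of_directed]
    · refine iSup_le fun n => ?_
      have := congrArg (fun μ => μ B) (map_marginalCdf_Ioc hp hψ hρ (Nat.cast_nonneg n : (0:ℝ) ≤ n))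
      simp only [Measure.map_apply hF hB, withDensity_apply _ hpre,
        Measure.restrict_restrict hpre] at this
      rw [this]
      exact Measure.restrict_mono (Set.Ioc_subset_Ioc_right (marginalCdf_mem_Icc hp hψ _).2)
        le_rfl B
    · refine Monotone.directed_le fun m n hmn => ?_
      exact Set.inter_subset_inter_right _ (Set.Ioc_subset_Ioc_right (by exact_mod_cast hmn))
  · rw [Measure.map_apply hF MeasurableSet.univ, Set.preimage_univ, withDensity_congr_ae hρ,
      withDensity_apply _ MeasurableSet.univ, Measure.restrict_univ,
      setLIntegral_Ioi_density hp.1.le hψ]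
    simp

end

/-! ### The change of variables from the data space to the cube. -/

/-- Replace the positive coordinates of `v` by `F_i (y_i)`. -/
def liftVec {d : ℕ} (F : Fin d → ℝ → ℝ) (y v : Fin d → ℝ) : Fin d → ℝ :=
  fun i => if 0 < y i then F i (y i) else v i

/-- The product weight that is `a_i (y_i)` in the positive coordinates and `b_i (v_i)` in the
others. -/
def liftWeight {d : ℕ} (a b : Fin d → ℝ → ℝ≥0∞) (y v : Fin d → ℝ) : ℝ≥0∞ :=
  ∏ i, if 0 < y i then a i (y i) else b i (v i)

instance (d : ℕ) : SigmaFinite (refMeasure d) := by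
  unfold refMeasure; infer_instance

section lift

variable {d : ℕ} {F : Fin d → ℝ → ℝ} {a b : Fin d → ℝ → ℝ≥0∞}

theorem measurable_liftVec (hF : ∀ i, Measurable (F i)) :
    Measurable fun q : (Fin d → ℝ) × (Fin d → ℝ) => liftVec F q.1 q.2 := by
  refine measurable_pi_lambda _ fun i => ?_
  have h1 : Measurable fun q : (Fin d → ℝ) × (Fin d → ℝ) => q.1 i := by fun_prop
  exact Measurable.ite (measurableSet_lt measurable_const h1) ((hF i).comp h1) (by fun_prop)

theorem measurable_liftWeight (ha : ∀ i, Measurable (a i)) (hb : ∀ i, Measurable (b i)) :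
    Measurable fun q : (Fin d → ℝ) × (Fin d → ℝ) => liftWeight a b q.1 q.2 := by
  refine Finset.measurable_prod _ fun i _ => ?_
  have h1 : Measurable fun q : (Fin d → ℝ) × (Fin d → ℝ) => q.1 i := by fun_prop
  have h2 : Measurable fun q : (Fin d → ℝ) × (Fin d → ℝ) => q.2 i := by fun_prop
  exact Measurable.ite (measurableSet_lt measurable_const h1) ((ha i).comp h1) ((hb i).comp h2)

/-- The atom at 0 contributes the `v`-part with weight `b`; on `(0, ∞)` the integrand does not
depend on `v`, which integrates to 1. -/
theorem lintegral_coord_lift {F : ℝ → ℝ} {a b : ℝ → ℝ≥0∞} (hF : Measurable F) (ha : Measurable a)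
    (hb : Measurable b) {B : Set ℝ} (hB : MeasurableSet B) :
    ∫⁻ y, ∫⁻ v, (if 0 < y then a y else b v) * B.indicator 1 (if 0 < y then F y else v) ∂unif
      ∂(Measure.dirac 0 + volume.restrict (Set.Ioi 0)) =
    (unif.withDensity b + ((volume.restrict (Set.Ioi 0)).withDensity a).map F) B := by
  have hm : Measurable fun q : ℝ × ℝ => (if 0 < q.1 then a q.1 else b q.2) *
      B.indicator (1 : ℝ → ℝ≥0∞) (if 0 < q.1 then F q.1 else q.2) := by
    refine (Measurable.ite (measurableSet_lt measurable_const measurable_fst)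
      (ha.comp measurable_fst) (hb.comp measurable_snd)).mul ?_
    exact (measurable_one.indicator hB).comp (Measurable.ite (measurableSet_lt measurable_const
      measurable_fst) (hF.comp measurable_fst) measurable_snd)
  rw [lintegral_add_measure, lintegral_dirac' _ hm.lintegral_prod_right', Measure.add_apply,
    Measure.map_apply hF hB, withDensity_apply _ hB, withDensity_apply _ (hF hB)]
  congr 1
  · rw [← lintegral_indicator hB]
    refine lintegral_congr fun v => ?_
    by_cases hv : v ∈ B <;> simp [hv]
  · rw [← lintegral_indicator (hF hB)]
    refine setLIntegral_congr_fun measurableSet_Ioi fun y hy => ?_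
    simp only [Set.mem_Ioi] at hy
    by_cases hv : F y ∈ B <;> simp [hy, hv]

/-- Changing variables in all coordinates at once. -/
theorem lintegral_liftWeight_mul (hF : ∀ i, Measurable (F i)) (ha : ∀ i, Measurable (a i))
    (hb : ∀ i, Measurable (b i)) (θ : Fin d → Measure ℝ) [∀ i, IsFiniteMeasure (θ i)]
    (h : ∀ i, unif.withDensity (b i) +
      ((volume.restrict (Set.Ioi 0)).withDensity (a i)).map (F i) = θ i)
    {g : (Fin d → ℝ) → ℝ≥0∞} (hg : Measurable g) :
    ∫⁻ y, ∫⁻ v, liftWeight a b y v * g (liftVec F y v) ∂(cubeMeasure d) ∂(refMeasure d) =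
      ∫⁻ u, g u ∂(Measure.pi θ) := by
  have hW := measurable_liftWeight ha hb
  have hL := measurable_liftVec hF
  have hpi : Measure.pi θ = (((refMeasure d).prod (cubeMeasure d)).withDensity
      fun q => liftWeight a b q.1 q.2).map fun q => liftVec F q.1 q.2 := by
    -- On a box both the weight and the indicator factor over the coordinates, so the claim reduces
    -- to a single coordinate.
    refine Measure.pi_eq fun s hs => ?_
    have hs' := MeasurableSet.univ_pi hs
    rw [Measure.map_apply hL hs', withDensity_apply _ (hL hs'), ← lintegral_indicator (hL hs'),
      lintegral_prod _ (hW.indicator (hL hs')).aemeasurable]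
    have hpt : ∀ y v : Fin d → ℝ, ((fun q : (Fin d → ℝ) × (Fin d → ℝ) => liftVec F q.1 q.2) ⁻¹'
        Set.univ.pi s).indicator (fun q => liftWeight a b q.1 q.2) (y, v) =
        ∏ i, ((if 0 < y i then a i (y i) else b i (v i)) *
          (s i).indicator 1 (if 0 < y i then F i (y i) else v i)) := fun y v => by
      by_cases hm : liftVec F y v ∈ Set.univ.pi s
      · have hm' : (y, v) ∈ (fun q : (Fin d → ℝ) × (Fin d → ℝ) => liftVec F q.1 q.2) ⁻¹'
          Set.univ.pi s := hm
        rw [Set.indicator_of_mem hm', liftWeight]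
        refine Finset.prod_congr rfl fun i _ => ?_
        have := hm i trivial
        simp only [liftVec] at this
        rw [Set.indicator_of_mem this, Pi.one_apply, mul_one]
      · have hm' : (y, v) ∉ (fun q : (Fin d → ℝ) × (Fin d → ℝ) => liftVec F q.1 q.2) ⁻¹'
          Set.univ.pi s := hm
        rw [Set.indicator_of_notMem hm']
        simp only [Set.mem_univ_pi, not_forall] at hm
        obtain ⟨i, hi⟩ := hm
        simp only [liftVec] at hi
        refine (Finset.prod_eq_zero (Finset.mem_univ i) ?_).symm
        rw [Set.indicator_of_notMem hi, mul_zero]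
    have hm : ∀ i, Measurable fun q : ℝ × ℝ => (if 0 < q.1 then a i q.1 else b i q.2) *
        (s i).indicator (1 : ℝ → ℝ≥0∞) (if 0 < q.1 then F i q.1 else q.2) := fun i => by
      refine (Measurable.ite (measurableSet_lt measurable_const measurable_fst)
        ((ha i).comp measurable_fst) ((hb i).comp measurable_snd)).mul ?_
      exact (measurable_one.indicator (hs i)).comp (Measurable.ite (measurableSet_lt
        measurable_const measurable_fst) ((hF i).comp measurable_fst) measurable_snd)
    simp only [hpt]
    have hin : ∀ y : Fin d → ℝ, ∫⁻ v, ∏ i, ((if 0 < y i then a i (y i) else b i (v i)) *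
          (s i).indicator 1 (if 0 < y i then F i (y i) else v i)) ∂(cubeMeasure d) =
        ∏ i, ∫⁻ t, ((if 0 < y i then a i (y i) else b i t) *
          (s i).indicator 1 (if 0 < y i then F i (y i) else t)) ∂unif := fun y =>
      lintegral_fin_prod (fun _ => unif) (f := fun i t => (if 0 < y i then a i (y i) else b i t) *
          (s i).indicator 1 (if 0 < y i then F i (y i) else t))
        fun i => (hm i).comp measurable_prodMk_left
    simp only [hin]
    refine (lintegral_fin_prod (fun _ => Measure.dirac 0 + volume.restrict (Set.Ioi 0))
      (f := fun i t => ∫⁻ v, ((if 0 < t then a i t else b i v) *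
          (s i).indicator 1 (if 0 < t then F i t else v)) ∂unif)
        fun i => (hm i).lintegral_prod_right').trans ?_
    refine Finset.prod_congr rfl fun i _ => ?_
    rw [lintegral_coord_lift (hF i) (ha i) (hb i) (hs i), h i]
  rw [hpi, lintegral_map hg hL]
  exact ((lintegral_withDensity_eq_lintegral_mul _ hW (hg.comp hL)).trans
    (lintegral_prod _ (hW.mul (hg.comp hL)).aemeasurable)).symm

end lift

section coordinate

variable {p : ℝ} {ψ : ℝ → ℝ} {ρ : ℝ → ℝ≥0∞}

theorem unif_restrict_Iic {t : ℝ} (ht : t ≤ 1) :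
    unif.restrict (Set.Iic t) = volume.restrict (Set.Icc 0 t) := by
  rw [unif, Measure.restrict_restrict measurableSet_Iic]
  congr 1
  ext s; simp only [Set.mem_inter_iff, Set.mem_Iic, Set.mem_Icc]
  constructor
  · rintro ⟨h1, h2, -⟩; exact ⟨h2, h1⟩
  · rintro ⟨h1, h2⟩; exact ⟨h2, h1, h2.trans ht⟩

theorem unif_restrict_Ioi {t : ℝ} (ht : 0 ≤ t) :
    unif.restrict (Set.Ioi t) = volume.restrict (Set.Ioc t 1) := by
  rw [unif, Measure.restrict_restrict measurableSet_Ioi]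
  congr 1
  ext s; simp only [Set.mem_inter_iff, Set.mem_Ioi, Set.mem_Icc, Set.mem_Ioc]
  constructor
  · rintro ⟨h1, h2, h3⟩; exact ⟨h1, h3⟩
  · rintro ⟨h1, h2⟩; exact ⟨h1, ht.trans h1.le, h2⟩

/-- One coordinate up to level `x`: the weights turn the reference measure into the uniform
distribution up to level `F(x)`. -/
theorem coord_lift_Iic (hp : p ∈ Set.Ioc (0 : ℝ) 1) (hψ : IsSeverityDensity ψ)
    (hρ : ρ =ᵐ[volume.restrict (Set.Ioi 0)] fun y => ENNReal.ofReal (p * ψ y)) (x : ℝ) :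
    unif.withDensity (fun v => if 0 ≤ x then (Set.Iic (1 - p)).indicator 1 v else 0) +
      ((volume.restrict (Set.Ioi 0)).withDensity ((Set.Iic x).indicator ρ)).map
        (marginalCdf p ψ) = unif.restrict (Set.Iic (marginalCdf p ψ x)) := by
  rw [withDensity_indicator measurableSet_Iic, Measure.restrict_restrict measurableSet_Iic,
    Set.inter_comm, Set.Ioi_inter_Iic]
  rcases lt_or_ge x 0 with hx | hx
  · have h0 : unif.restrict (Set.Iic 0) = 0 := by
      rw [unif_restrict_Iic zero_le_one]; simp
    rw [Set.Ioc_eq_empty (not_lt.2 hx.le), marginalCdf_of_neg hx, h0]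
    simp [not_le.2 hx]
  · simp only [if_pos hx]
    rw [map_marginalCdf_Ioc hp hψ hρ hx, withDensity_indicator measurableSet_Iic, withDensity_one,
      unif_restrict_Iic (by linarith [hp.1]), unif_restrict_Iic (marginalCdf_mem_Icc hp hψ x).2,
      ← Measure.restrict_union _ measurableSet_Ioc, Set.Icc_union_Ioc_eq_Icc]
    · linarith [hp.2]
    · rw [marginalCdf_of_nonneg hx]
      linarith [mul_nonneg hp.1.le (hψ.severityCdf_nonneg x)]
    · exact Set.disjoint_left.2 fun t h1 h2 => absurd h1.2 (not_le.2 h2.1)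

/-- Weights that turn the reference measure of one coordinate into the uniform distribution and
vanish only where the severity density does. -/
theorem coord_lift_half (hp : p ∈ Set.Ioc (0 : ℝ) 1) (hψ : IsSeverityDensity ψ)
    (hρm : Measurable ρ)
    (hρ : ρ =ᵐ[volume.restrict (Set.Ioi 0)] fun y => ENNReal.ofReal (p * ψ y)) :
    unif.withDensity ((Set.Iic (1 - p)).indicator 1 + (Set.Ioi (1 - p)).indicator fun _ => 2⁻¹) +
      ((volume.restrict (Set.Ioi 0)).withDensity ((2⁻¹ : ℝ≥0∞) • ρ)).map
        (marginalCdf p ψ) = unif := by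
  -- The mass on `(1 - p, 1]` comes half from `v` and half from `y`; that on `[0, 1 - p]` comes from
  -- `v` alone.
  rw [withDensity_add_left (measurable_one.indicator measurableSet_Iic),
    withDensity_indicator measurableSet_Iic, withDensity_one,
    withDensity_indicator measurableSet_Ioi, withDensity_const, withDensity_smul _ hρm,
    Measure.map_smul, map_marginalCdf_Ioi hp hψ hρ, unif_restrict_Ioi (by linarith [hp.2]),
    add_assoc, ← add_smul, ENNReal.inv_two_add_inv_two, one_smul,
    unif_restrict_Iic (by linarith [hp.1]), ← Measure.restrict_union _ measurableSet_Ioc,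
    Set.Icc_union_Ioc_eq_Icc]
  · rfl
  · linarith [hp.2]
  · linarith [hp.1]
  · exact Set.disjoint_left.2 fun t h1 h2 => absurd h1.2 (not_le.2 h2.1)

end coordinate

/-! ### The density of one observation. -/

section observation

variable {d : ℕ} {p : Fin d → ℝ} {ψ : Fin d → ℝ → ℝ} {ρ : Fin d → ℝ → ℝ≥0∞}
  {c : (Fin d → ℝ) → ℝ≥0∞}

/-- The density of one observation with respect to the reference measure, for a copula density `c`
and severity densities `ρ_i = p_i ψ_i`. -/
def obsDensity (c : (Fin d → ℝ) → ℝ≥0∞) (p : Fin d → ℝ) (ψ : Fin d → ℝ → ℝ)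
    (ρ : Fin d → ℝ → ℝ≥0∞) (y : Fin d → ℝ) : ℝ≥0∞ :=
  ∫⁻ v, liftWeight ρ (fun i => (Set.Iic (1 - p i)).indicator 1) y v *
    c (liftVec (fun i => marginalCdf (p i) (ψ i)) y v) ∂(cubeMeasure d)

theorem measurable_obsDensity (hψ : ∀ i, IsSeverityDensity (ψ i)) (hρm : ∀ i, Measurable (ρ i))
    (hc : Measurable c) : Measurable (obsDensity c p ψ ρ) := by
  refine Measurable.lintegral_prod_right' (f := fun q : (Fin d → ℝ) × (Fin d → ℝ) =>
    liftWeight ρ (fun i => (Set.Iic (1 - p i)).indicator 1) q.1 q.2 *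
    c (liftVec (fun i => marginalCdf (p i) (ψ i)) q.1 q.2)) ?_
  exact (measurable_liftWeight hρm fun i => measurable_one.indicator measurableSet_Iic).mul
    (hc.comp (measurable_liftVec fun i => measurable_marginalCdf (hψ i)))

theorem ae_refMeasure_nonneg (d : ℕ) : ∀ᵐ y ∂(refMeasure d), ∀ i, 0 ≤ y i := by
  refine ae_all_iff.2 fun i => ?_
  have : ∀ᵐ t ∂(Measure.dirac 0 + volume.restrict (Set.Ioi 0) : Measure ℝ), 0 ≤ t := by
    rw [ae_add_measure_iff]
    refine ⟨?_, ?_⟩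
    · rw [ae_dirac_iff measurableSet_Ici]
    · filter_upwards [ae_restrict_mem measurableSet_Ioi] with t ht using le_of_lt ht
  exact (Measure.tendsto_eval_ae_ae
    (μ := fun _ : Fin d => (Measure.dirac 0 + volume.restrict (Set.Ioi 0) : Measure ℝ))
    (i := i)).eventually this

/-- The restriction `y ≤ x` factors over coordinates and is absorbed into the weights: `y_i ≤ x_i`
where active, `0 ≤ x_i` where inactive. The lift then produces the uniform measure on the orthant
below `F(x)`. -/
theorem setLIntegral_obsDensity_Iic (hp : ∀ i, p i ∈ Set.Ioc (0 : ℝ) 1)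
    (hψ : ∀ i, IsSeverityDensity (ψ i)) (hρm : ∀ i, Measurable (ρ i))
    (hρ : ∀ i, ρ i =ᵐ[volume.restrict (Set.Ioi 0)] fun y => ENNReal.ofReal (p i * ψ i y))
    (hc : Measurable c) (x : Fin d → ℝ) :
    ∫⁻ y in Set.Iic x, obsDensity c p ψ ρ y ∂(refMeasure d) =
      ∫⁻ u in Set.Iic (cdfVec p ψ x), c u ∂(cubeMeasure d) := by
  have hb : ∀ i, Measurable fun v : ℝ =>
      if 0 ≤ x i then (Set.Iic (1 - p i)).indicator (1 : ℝ → ℝ≥0∞) v else 0 := fun i => by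
    split_ifs
    · exact measurable_one.indicator measurableSet_Iic
    · exact measurable_const
  have key := lintegral_liftWeight_mul (fun i => measurable_marginalCdf (p := p i) (hψ i))
    (fun i => (hρm i).indicator (measurableSet_Iic (a := x i))) hb
    (fun i => unif.restrict (Set.Iic (marginalCdf (p i) (ψ i) (x i))))
    (fun i => coord_lift_Iic (hp i) (hψ i) (hρ i) (x i)) hc
  rw [← Measure.restrict_pi_pi, Set.pi_univ_Iic] at key
  refine Eq.trans ?_ key
  rw [← lintegral_indicator measurableSet_Iic]
  refine lintegral_congr_ae ?_
  filter_upwards [ae_refMeasure_nonneg d] with y hy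
  by_cases hyx : y ≤ x
  · rw [Set.indicator_of_mem (Set.mem_Iic.2 hyx), obsDensity]
    refine lintegral_congr fun v => ?_
    congr 1
    refine Finset.prod_congr rfl fun i _ => ?_
    beta_reduce
    rw [Set.indicator_of_mem (Set.mem_Iic.2 (hyx i)), if_pos ((hy i).trans (hyx i))]
  · rw [Set.indicator_of_notMem (by simpa using hyx)]
    symm
    refine (lintegral_congr fun v => ?_).trans lintegral_zero
    simp only [Pi.le_def, not_forall] at hyx
    obtain ⟨i, hi⟩ := hyx
    rw [liftWeight, Finset.prod_eq_zero (Finset.mem_univ i), zero_mul]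
    split_ifs with h1 h2
    · exact Set.indicator_of_notMem (by simpa using hi) _
    · exact absurd (le_antisymm (not_lt.1 h1) (hy i) ▸ h2) hi
    · rfl

/-- Transfers null sets from the cube to the data space. The weights of `obsDensity` would not do:
if `p i = 1`, the inactive weight vanishes almost everywhere although the reference measure charges
`y i = 0`. The halved weights vanish only with `ρ`. Some `v` is enough, since slice masses depend on
the lifted point only through its active coordinates. -/
theorem ae_forall_liftVec (hp : ∀ i, p i ∈ Set.Ioc (0 : ℝ) 1)
    (hψ : ∀ i, IsSeverityDensity (ψ i)) (hρm : ∀ i, Measurable (ρ i))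
    (hρ : ∀ i, ρ i =ᵐ[volume.restrict (Set.Ioi 0)] fun y => ENNReal.ofReal (p i * ψ i y))
    {Q : (Fin d → ℝ) → Prop} (hQ : ∀ᵐ u ∂(cubeMeasure d), Q u) :
    ∀ᵐ y ∂(refMeasure d), (∀ i, 0 < y i → ρ i (y i) ≠ 0) →
      ∃ v, Q (liftVec (fun i => marginalCdf (p i) (ψ i)) y v) := by
  obtain ⟨B, hQB, hB, hB0⟩ := exists_measurable_superset_of_null (ae_iff.1 hQ)
  have hF := fun i => measurable_marginalCdf (p := p i) (hψ i)
  have ha : ∀ i, Measurable ((2⁻¹ : ℝ≥0∞) • ρ i) := fun i => (hρm i).const_smul _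
  have hb : ∀ i, Measurable ((Set.Iic (1 - p i)).indicator 1 +
      (Set.Ioi (1 - p i)).indicator fun _ => (2⁻¹ : ℝ≥0∞)) := fun i =>
    (measurable_one.indicator measurableSet_Iic).add (measurable_const.indicator measurableSet_Ioi)
  have hone : Measurable (B.indicator (1 : (Fin d → ℝ) → ℝ≥0∞)) := measurable_one.indicator hB
  have key := lintegral_liftWeight_mul hF ha hb (fun _ => unif)
    (fun i => coord_lift_half (hp i) (hψ i) (hρm i) (hρ i)) hone
  rw [lintegral_indicator_one hB, show Measure.pi (fun _ : Fin d => unif) B = 0 from hB0] at key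
  have hm : Measurable fun q : (Fin d → ℝ) × (Fin d → ℝ) =>
      liftWeight (fun i => (2⁻¹ : ℝ≥0∞) • ρ i) (fun i => (Set.Iic (1 - p i)).indicator 1 +
        (Set.Ioi (1 - p i)).indicator fun _ => (2⁻¹ : ℝ≥0∞)) q.1 q.2 *
      B.indicator 1 (liftVec (fun i => marginalCdf (p i) (ψ i)) q.1 q.2) :=
    (measurable_liftWeight ha hb).mul (hone.comp (measurable_liftVec hF))
  rw [lintegral_eq_zero_iff hm.lintegral_prod_right'] at key
  filter_upwards [key] with y hy hpos
  have hmy := hm.comp (measurable_prodMk_left (x := y))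
  obtain ⟨v, hv⟩ := ((lintegral_eq_zero_iff hmy).1 hy).exists
  refine ⟨v, ?_⟩
  by_contra hnQ
  have hmem : liftVec (fun i => marginalCdf (p i) (ψ i)) y v ∈ B := hQB hnQ
  simp only [Function.comp, Pi.zero_apply, Set.indicator_of_mem hmem, Pi.one_apply, mul_one] at hv
  rw [liftWeight, Finset.prod_eq_zero_iff] at hv
  obtain ⟨i, -, hi⟩ := hv
  split_ifs at hi with h
  · simp only [Pi.smul_apply, smul_eq_mul, mul_eq_zero, ENNReal.inv_eq_zero] at hi
    exact hi.elim (by simp) (hpos i h)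
  · rcases le_or_gt (v i) (1 - p i) with h' | h' <;>
      simp [Set.indicator, h', not_le.2, not_lt.2] at hi

/-- Inactive coordinates have `y_i = 0` and `F_i(0) = 1 - p_i`, so the indicator weights are exactly
the constraint `v_i ≤ F_i(y_i)` of the slice. -/
theorem obsDensity_eq_sliceMass (hc : Measurable c) {y : Fin d → ℝ} (hy : ∀ i, 0 ≤ y i) :
    obsDensity c p ψ ρ y = (∏ i ∈ activeSet y, ρ i (y i)) *
      sliceMass c (activeSet y) (cdfVec p ψ y) (cdfVec p ψ y) := by
  have hact : ∀ i, i ∈ activeSet y ↔ 0 < y i := fun i => by simp [activeSet]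
  rw [obsDensity, sliceMass, ← lintegral_const_mul _ ((measurable_slice hc _ _).indicator
    (measurableSet_forall_notMem_le _ _))]
  refine lintegral_congr fun v => ?_
  have h1 : liftVec (fun i => marginalCdf (p i) (ψ i)) y v =
      (activeSet y).piecewise (cdfVec p ψ y) v := by
    funext i
    by_cases hi : 0 < y i
    · rw [Finset.piecewise_eq_of_mem _ _ _ ((hact i).2 hi), liftVec, if_pos hi]; rfl
    · rw [Finset.piecewise_eq_of_notMem _ _ _ (mt (hact i).1 hi), liftVec, if_neg hi]
  have h2 : liftWeight ρ (fun i => (Set.Iic (1 - p i)).indicator 1) y v =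
      (∏ i ∈ activeSet y, ρ i (y i)) *
        ∏ i ∈ Finset.univ.filter (fun i => ¬ 0 < y i),
          (Set.Iic (1 - p i)).indicator (1 : ℝ → ℝ≥0∞) (v i) := by
    rw [liftWeight, Finset.prod_ite]; rfl
  rw [h1, h2, mul_assoc]
  congr 1
  have hF : ∀ i ∉ activeSet y, cdfVec p ψ y i = 1 - p i := fun i hi => by
    have : y i = 0 := le_antisymm (not_lt.1 (mt (hact i).2 hi)) (hy i)
    rw [cdfVec, this, marginalCdf_zero]
  by_cases hv : v ∈ {v : Fin d → ℝ | ∀ i ∉ activeSet y, v i ≤ cdfVec p ψ y i}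
  · rw [Set.indicator_of_mem hv, Finset.prod_eq_one, one_mul]
    intro i hi
    have hi' : i ∉ activeSet y := mt (hact i).1 (Finset.mem_filter.1 hi).2
    have hvi : v i ∈ Set.Iic (1 - p i) := hF i hi' ▸ hv i hi'
    rw [Set.indicator_of_mem hvi, Pi.one_apply]
  · rw [Set.indicator_of_notMem hv]
    simp only [Set.mem_ofPred_eq, not_forall] at hv
    obtain ⟨i, hi, hvi⟩ := hv
    rw [Finset.prod_eq_zero (i := i), zero_mul]
    · simpa using mt (hact i).2 hi
    · exact Set.indicator_of_notMem (by rw [hF i hi] at hvi; exact hvi) _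

end observation

/-! ### The copula density and the log-likelihood of one observation. -/

theorem IsAbsContCopula.exists_density {d : ℕ} {C : (Fin d → ℝ) → ℝ} (hC : IsAbsContCopula C) :
    ∃ c : (Fin d → ℝ) → ℝ≥0∞, Measurable c ∧ ∫⁻ u, c u ∂(cubeMeasure d) = 1 ∧
      ∀ u ∈ Set.Icc (0 : Fin d → ℝ) 1,
        C u = (∫⁻ v in Set.Iic u, c v ∂(cubeMeasure d)).toReal := by
  obtain ⟨κ, hκ, hac, hmarg, hcdf⟩ := hC
  have hIcc : κ (Set.Icc 0 1)ᶜ = 0 := by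
    have hi : ∀ i, ∀ᵐ u ∂κ, u i ∈ Set.Icc (0 : ℝ) 1 := fun i => by
      have : ∀ᵐ t ∂(κ.map fun u => u i), t ∈ Set.Icc (0 : ℝ) 1 := by
        rw [hmarg i]; exact ae_restrict_mem measurableSet_Icc
      exact ae_of_ae_map (measurable_pi_apply i).aemeasurable this
    have : ∀ᵐ u ∂κ, u ∈ Set.Icc (0 : Fin d → ℝ) 1 := by
      filter_upwards [ae_all_iff.2 hi] with u hu
      exact ⟨fun i => (hu i).1, fun i => (hu i).2⟩
    exact this
  have hac' : κ ≪ cubeMeasure d := by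
    rw [cubeMeasure_eq_restrict, ← Measure.restrict_eq_self_of_ae_mem (μ := κ)
      (s := Set.Icc (0 : Fin d → ℝ) 1) hIcc]
    exact hac.restrict _
  have : SigmaFinite (cubeMeasure d) := inferInstance
  have : κ.HaveLebesgueDecomposition (cubeMeasure d) :=
    Measure.haveLebesgueDecomposition_of_sigmaFinite κ (cubeMeasure d)
  have hden := Measure.withDensity_rnDeriv_eq κ (cubeMeasure d) hac'
  refine ⟨κ.rnDeriv (cubeMeasure d), Measure.measurable_rnDeriv _ _, ?_, fun u hu => ?_⟩
  · rw [← setLIntegral_univ, ← withDensity_apply _ MeasurableSet.univ, hden, measure_univ]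
  · rw [hcdf u hu, ← withDensity_apply _ measurableSet_Iic, hden, Measure.real]

theorem sliceMass_empty {d : ℕ} (c : (Fin d → ℝ) → ℝ≥0∞) (u w : Fin d → ℝ) :
    sliceMass c ∅ u w = ∫⁻ v in Set.Iic w, c v ∂(cubeMeasure d) := by
  rw [sliceMass, ← lintegral_indicator measurableSet_Iic]
  have h1 : {v : Fin d → ℝ | ∀ i ∉ (∅ : Finset (Fin d)), v i ≤ w i} = Set.Iic w := by
    ext v; simp [Pi.le_def]
  have h2 : ∀ v : Fin d → ℝ, (∅ : Finset (Fin d)).piecewise u v = v := fun v =>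
    funext fun j => Finset.piecewise_eq_of_notMem _ _ _ (by simp)
  rw [h1]
  simp only [h2]

theorem log_finset_prod {α : Type*} (s : Finset α) (f : α → ℝ≥0∞) :
    ENNReal.log (∏ i ∈ s, f i) = ∑ i ∈ s, ENNReal.log (f i) := by
  classical
  induction s using Finset.induction_on with
  | empty => simp
  | insert a s ha ih => rw [Finset.prod_insert ha, Finset.sum_insert ha, ENNReal.log_mul_add, ih]

theorem eln_add_sum_eln {α : Type*} (s : Finset α) (a : ℝ) (f : α → ℝ) :
    eln a + ∑ i ∈ s, eln (f i) =
      ENNReal.log (ENNReal.ofReal a * ∏ i ∈ s, ENNReal.ofReal (f i)) := by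
  rw [ENNReal.log_mul_add, log_finset_prod]; rfl

section observation

variable {d : ℕ} {p : Fin d → ℝ} {ψ : Fin d → ℝ → ℝ} {ρ : Fin d → ℝ → ℝ≥0∞}
  {c : (Fin d → ℝ) → ℝ≥0∞} {C : (Fin d → ℝ) → ℝ}

theorem cdfVec_mem_Icc (hp : ∀ i, p i ∈ Set.Ioc (0 : ℝ) 1) (hψ : ∀ i, IsSeverityDensity (ψ i))
    (x : Fin d → ℝ) : cdfVec p ψ x ∈ Set.Icc (0 : Fin d → ℝ) 1 :=
  ⟨fun i => (marginalCdf_mem_Icc (hp i) (hψ i) (x i)).1,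
    fun i => (marginalCdf_mem_Icc (hp i) (hψ i) (x i)).2⟩

theorem ae_refMeasure_density_eq
    (hρ : ∀ i, ρ i =ᵐ[volume.restrict (Set.Ioi 0)] fun y => ENNReal.ofReal (p i * ψ i y)) :
    ∀ᵐ y ∂(refMeasure d), ∀ i, 0 < y i → ρ i (y i) = ENNReal.ofReal (p i * ψ i (y i)) := by
  refine ae_all_iff.2 fun i => ?_
  have : ∀ᵐ t ∂(Measure.dirac 0 + volume.restrict (Set.Ioi 0) : Measure ℝ),
      0 < t → ρ i t = ENNReal.ofReal (p i * ψ i t) := by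
    rw [ae_add_measure_iff]
    refine ⟨?_, ?_⟩
    · rw [ae_dirac_eq]
      exact fun h => absurd h (lt_irrefl 0)
    · filter_upwards [hρ i] with t ht _ using ht
  exact (Measure.tendsto_eval_ae_ae
    (μ := fun _ : Fin d => (Measure.dirac 0 + volume.restrict (Set.Ioi 0) : Measure ℝ))
    (i := i)).eventually this

theorem sliceMass_piecewise (A : Finset (Fin d)) (u v w : Fin d → ℝ) :
    sliceMass c A (A.piecewise u v) w = sliceMass c A u w := by
  unfold sliceMass
  simp only [Finset.piecewise_idem_left]

theorem sliceTotal_piecewise (A : Finset (Fin d)) (u v : Fin d → ℝ) :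
    sliceTotal c A (A.piecewise u v) = sliceTotal c A u := by
  unfold sliceTotal
  simp only [Finset.piecewise_idem_left]

theorem liftVec_eq_piecewise (y v : Fin d → ℝ) :
    liftVec (fun i => marginalCdf (p i) (ψ i)) y v =
      (activeSet y).piecewise (cdfVec p ψ y) v := by
  funext i
  by_cases hi : 0 < y i
  · rw [Finset.piecewise_eq_of_mem _ _ _ (by simpa [activeSet] using hi), liftVec, if_pos hi]; rfl
  · rw [Finset.piecewise_eq_of_notMem _ _ _ (by simpa [activeSet] using hi), liftVec, if_neg hi]

theorem ae_log_obsDensity (hp : ∀ i, p i ∈ Set.Ioc (0 : ℝ) 1)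
    (hψ : ∀ i, IsSeverityDensity (ψ i)) (hρm : ∀ i, Measurable (ρ i))
    (hρ : ∀ i, ρ i =ᵐ[volume.restrict (Set.Ioi 0)] fun y => ENNReal.ofReal (p i * ψ i y))
    (hc : Measurable c) (hfin : ∫⁻ u, c u ∂(cubeMeasure d) ≠ ∞)
    (hC : ∀ u ∈ Set.Icc (0 : Fin d → ℝ) 1, C u = (∫⁻ v in Set.Iic u, c v ∂(cubeMeasure d)).toReal) :
    ∀ᵐ y ∂(refMeasure d), ∀ l, IsEnumeration l (activeSet y) →
      ENNReal.log (obsDensity c p ψ ρ y) = eln (mixedPartial C l (cdfVec p ψ y)) +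
        ∑ i ∈ activeSet y, eln (p i * ψ i (y i)) ∧
      ((∀ i ∈ activeSet y, 0 < ψ i (y i)) → HasMixedPartial C l (cdfVec p ψ y) ∧
        0 ≤ mixedPartial C l (cdfVec p ψ y)) := by
  have hQ : ∀ᵐ u ∂(cubeMeasure d), ∀ l : List (Fin d), l.Nodup →
      sliceTotal c l.toFinset u ≠ ∞ ∧ ∀ w ∈ Set.Icc (0 : Fin d → ℝ) 1,
      HasMixedPartial C l (l.toFinset.piecewise u w) ∧
        mixedPartial C l (l.toFinset.piecewise u w) = (sliceMass c l.toFinset u w).toReal := by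
    -- There are countably many lists, so one null set serves all orders of differentiation.
    refine ae_all_iff.2 fun l => ?_
    by_cases hl : l.Nodup
    · filter_upwards [ae_mixedPartial_eq_sliceMass (C := C) hc hfin
        (fun u hu v => by rw [sliceMass_empty, hC u hu]) l hl,
        ae_lt_top (measurable_sliceTotal hc l.toFinset)
        (by rwa [lintegral_sliceTotal hc])] with u h1 h2 _ using ⟨h2.ne, h1⟩
    · exact .of_forall fun u h => absurd h hl
  filter_upwards [ae_refMeasure_nonneg d, ae_refMeasure_density_eq hρ,
    ae_forall_liftVec hp hψ hρm hρ hQ] with y hy hyρ hyQ l hl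
  have hact : ∀ i, i ∈ activeSet y ↔ 0 < y i := fun i => by simp [activeSet]
  have hprod : ∏ i ∈ activeSet y, ρ i (y i) =
      ∏ i ∈ activeSet y, ENNReal.ofReal (p i * ψ i (y i)) :=
    Finset.prod_congr rfl fun i hi => hyρ i ((hact i).1 hi)
  have hself : (activeSet y).piecewise (cdfVec p ψ y) (cdfVec p ψ y) = cdfVec p ψ y :=
    Finset.piecewise_same _ _
  have hmain : (∀ i ∈ activeSet y, 0 < ψ i (y i)) → HasMixedPartial C l (cdfVec p ψ y) ∧
      mixedPartial C l (cdfVec p ψ y) =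
        (sliceMass c (activeSet y) (cdfVec p ψ y) (cdfVec p ψ y)).toReal ∧
      sliceMass c (activeSet y) (cdfVec p ψ y) (cdfVec p ψ y) ≠ ∞ := fun hpos => by
    obtain ⟨v, hv⟩ := hyQ fun i hi => by
      rw [hyρ i hi]
      exact (ENNReal.ofReal_pos.2 (mul_pos (hp i).1 (hpos i ((hact i).2 hi)))).ne'
    obtain ⟨h1, h2⟩ := hv l hl.1
    have h3 := h2 _ (cdfVec_mem_Icc hp hψ y)
    rw [hl.2, liftVec_eq_piecewise, sliceTotal_piecewise] at h1
    rw [hl.2, liftVec_eq_piecewise, sliceMass_piecewise, Finset.piecewise_idem_left, hself] at h3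
    exact ⟨h3.1, h3.2, ne_top_of_le_ne_top h1 (sliceMass_le_sliceTotal _ _ _)⟩
  refine ⟨?_, fun hpos => ⟨(hmain hpos).1, (hmain hpos).2.1 ▸ ENNReal.toReal_nonneg⟩⟩
  rw [eln_add_sum_eln, obsDensity_eq_sliceMass hc hy, hprod, mul_comm]
  by_cases hpos : ∀ i ∈ activeSet y, 0 < ψ i (y i)
  · obtain ⟨-, h2, h3⟩ := hmain hpos
    rw [h2, ENNReal.ofReal_toReal h3]
  -- A vanishing severity factor makes both sides `-∞`, whatever value the derivative or the slice
  -- mass takes.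
  · have h0 : ∏ i ∈ activeSet y, ENNReal.ofReal (p i * ψ i (y i)) = 0 := by
      simp only [not_forall] at hpos
      obtain ⟨i, hi, hψi⟩ := hpos
      refine Finset.prod_eq_zero hi (ENNReal.ofReal_eq_zero.2 ?_)
      exact mul_nonpos_of_nonneg_of_nonpos (hp i).1.le (not_lt.1 hψi)
    rw [h0, mul_zero, mul_zero]

/-- Integrability makes `ψ i` only almost everywhere measurable; the change of variables needs a
Borel version. -/
theorem exists_measurable_density (hψ : ∀ i, IsSeverityDensity (ψ i)) :
    ∃ ρ : Fin d → ℝ → ℝ≥0∞, (∀ i, Measurable (ρ i)) ∧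
      ∀ i, ρ i =ᵐ[volume.restrict (Set.Ioi 0)] fun y => ENNReal.ofReal (p i * ψ i y) := by
  refine ⟨fun i y => ENNReal.ofReal (p i * (hψ i).integrable.aestronglyMeasurable.mk _ y),
    fun i => ENNReal.measurable_ofReal.comp
      ((hψ i).integrable.aestronglyMeasurable.stronglyMeasurable_mk.measurable.const_mul _),
    fun i => ?_⟩
  filter_upwards [(hψ i).integrable.aestronglyMeasurable.ae_eq_mk] with y hy
  rw [← hy]

theorem eq_withDensity_obsDensity (hp : ∀ i, p i ∈ Set.Ioc (0 : ℝ) 1)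
    (hψ : ∀ i, IsSeverityDensity (ψ i)) (hρm : ∀ i, Measurable (ρ i))
    (hρ : ∀ i, ρ i =ᵐ[volume.restrict (Set.Ioi 0)] fun y => ENNReal.ofReal (p i * ψ i y))
    (hc : Measurable c) (hfin : ∫⁻ u, c u ∂(cubeMeasure d) ≠ ∞)
    (hC : ∀ u ∈ Set.Icc (0 : Fin d → ℝ) 1, C u = (∫⁻ v in Set.Iic u, c v ∂(cubeMeasure d)).toReal)
    (μ : Measure (Fin d → ℝ)) [IsFiniteMeasure μ]
    (hμ : ∀ x, μ.real (Set.Iic x) = C (cdfVec p ψ x)) :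
    μ = (refMeasure d).withDensity (obsDensity c p ψ ρ) := by
  refine measure_ext_of_Iic _ _ fun x => ?_
  rw [withDensity_apply _ measurableSet_Iic, setLIntegral_obsDensity_Iic hp hψ hρm hρ hc]
  have := hμ x
  rw [hC _ (cdfVec_mem_Icc hp hψ x), Measure.real, ENNReal.toReal_eq_toReal_iff'
    (measure_ne_top _ _) (ne_top_of_le_ne_top hfin (setLIntegral_le_lintegral _ _))] at this
  exact this

end observation

/-! ### The chain rule for continuous severity densities. -/

section chain

variable {φ f : ℝ → ℝ} {f' a : ℝ}

/-- By the inverse function theorem `φ` is, near `f a`, the composite of `φ ∘ f` with a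
differentiable local inverse of `f`. -/
theorem differentiableAt_comp_iff_of_strict (hf : HasStrictDerivAt f f' a) (hf' : f' ≠ 0) :
    DifferentiableAt ℝ (fun s => φ (f s)) a ↔ DifferentiableAt ℝ φ (f a) := by
  constructor
  · intro h
    have hg := (hf.to_localInverse hf').hasDerivAt.differentiableAt
    have hga : hf.localInverse f f' a hf' (f a) = a :=
      (hf.eventually_left_inverse hf').self_of_nhds
    have hcomp : DifferentiableAt ℝ (fun y => φ (f (hf.localInverse f f' a hf' y))) (f a) :=
      DifferentiableAt.comp (g := fun s => φ (f s)) (f a) (by rwa [hga]) hg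
    refine hcomp.congr_of_eventuallyEq ?_
    filter_upwards [hf.eventually_right_inverse hf'] with y hy
    rw [hy]
  · intro h
    exact h.comp a hf.hasDerivAt.differentiableAt

theorem deriv_comp_of_strict (hf : HasStrictDerivAt f f' a) (hf' : f' ≠ 0) :
    deriv (fun s => φ (f s)) a = deriv φ (f a) * f' := by
  by_cases h : DifferentiableAt ℝ φ (f a)
  · exact (h.hasDerivAt.comp a hf.hasDerivAt).deriv
  -- Without differentiability both sides are the default value 0, so the identity is unconditional.
  · rw [deriv_zero_of_not_differentiableAt h, zero_mul, deriv_zero_of_not_differentiableAt]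
    exact mt (differentiableAt_comp_iff_of_strict hf hf').1 h

theorem differentiableAt_mul_const_iff {c : ℝ} (hc : c ≠ 0) :
    DifferentiableAt ℝ (fun s => φ s * c) a ↔ DifferentiableAt ℝ φ a := by
  refine ⟨fun h => ?_, fun h => h.mul_const c⟩
  simpa [mul_assoc, hc] using h.mul_const c⁻¹

end chain

theorem hasStrictDerivAt_marginalCdf {p : ℝ} {ψ : ℝ → ℝ} (hψ : IsSeverityDensity ψ)
    (hcont : ContinuousOn ψ (Set.Ioi 0)) {x : ℝ} (hx : 0 < x) :
    HasStrictDerivAt (marginalCdf p ψ) (p * ψ x) x := by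
  have hat : ContinuousAt ψ x := hcont.continuousAt (Ioi_mem_nhds hx)
  have hII : IntervalIntegrable ψ volume 0 x :=
    (intervalIntegrable_iff_integrableOn_Ioc_of_le hx.le).2
      (hψ.integrable.mono_set Set.Ioc_subset_Ioi_self)
  have hmeas : StronglyMeasurableAtFilter ψ (𝓝 x) :=
    ⟨Set.Ioi 0, Ioi_mem_nhds hx, hψ.integrable.aestronglyMeasurable⟩
  have h := ((intervalIntegral.integral_hasStrictDerivAt_right hII hmeas hat).const_mul p).const_add
    (1 - p)
  refine h.congr_of_eventuallyEq ?_
  filter_upwards [Ioi_mem_nhds hx] with s hs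
  rw [marginalCdf_of_nonneg (le_of_lt hs), severityCdf, intervalIntegral.integral_of_le (le_of_lt hs)]

theorem cdfVec_update {d : ℕ} (p : Fin d → ℝ) (ψ : Fin d → ℝ → ℝ) (z : Fin d → ℝ) (i : Fin d)
    (s : ℝ) : cdfVec p ψ (Function.update z i s) =
      Function.update (cdfVec p ψ z) i (marginalCdf (p i) (ψ i) s) := by
  funext j
  by_cases hj : j = i
  · subst hj; simp [cdfVec]
  · simp [cdfVec, hj]

/-- Chain rule for iterated partial derivatives of `C ∘ F`, one coordinate after the other. -/
theorem mixedPartial_comp_cdfVec {d : ℕ} {p : Fin d → ℝ} (hp : ∀ i, 0 < p i)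
    {ψ : Fin d → ℝ → ℝ} (hψ : ∀ i, IsSeverityDensity (ψ i))
    (hcont : ∀ i, ContinuousOn (ψ i) (Set.Ioi 0)) {g C : (Fin d → ℝ) → ℝ} {I : Finset (Fin d)}
    (hg : ∀ z, (∀ i ∈ I, 0 < z i) → (∀ i ∉ I, z i = 0) → g z = C (cdfVec p ψ z))
    (l : List (Fin d)) (hl : l.Nodup) (hlI : ∀ i ∈ l, i ∈ I) (z : Fin d → ℝ)
    (hz : ∀ i ∈ I, 0 < z i ∧ 0 < ψ i (z i)) (hz0 : ∀ i ∉ I, z i = 0) :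
    (HasMixedPartial g l z ↔ HasMixedPartial C l (cdfVec p ψ z)) ∧
      mixedPartial g l z =
        mixedPartial C l (cdfVec p ψ z) * (l.map fun i => p i * ψ i (z i)).prod := by
  induction l generalizing z with
  | nil =>
    refine ⟨Iff.rfl, ?_⟩
    simpa [mixedPartial] using hg z (fun i hi => (hz i hi).1) hz0
  | cons i l ih =>
    rw [List.nodup_cons] at hl
    have hiI : i ∈ I := hlI i List.mem_cons_self
    have hstrict : HasStrictDerivAt (marginalCdf (p i) (ψ i)) (p i * ψ i (z i)) (z i) :=
      hasStrictDerivAt_marginalCdf (hψ i) (hcont i) (hz i hiI).1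
    have hne : p i * ψ i (z i) ≠ 0 := (mul_pos (hp i) (hz i hiI).2).ne'
    have hev : ∀ᶠ s in 𝓝 (z i),
        (HasMixedPartial g l (Function.update z i s) ↔
          HasMixedPartial C l (Function.update (cdfVec p ψ z) i (marginalCdf (p i) (ψ i) s))) ∧
        mixedPartial g l (Function.update z i s) =
          mixedPartial C l (Function.update (cdfVec p ψ z) i (marginalCdf (p i) (ψ i) s)) *
            (l.map fun j => p j * ψ j (z j)).prod := by
      have hpos : ∀ᶠ s in 𝓝 (z i), 0 < ψ i s :=
        ((hcont i).continuousAt (Ioi_mem_nhds (hz i hiI).1)).eventually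
          (lt_mem_nhds (hz i hiI).2)
      filter_upwards [hpos, Ioi_mem_nhds (hz i hiI).1] with s hs hs0
      have := ih hl.2 (fun j hj => hlI j (List.mem_cons_of_mem i hj)) (Function.update z i s)
        (fun j hj => by
          by_cases hji : j = i
          · subst hji; simpa using ⟨hs0, hs⟩
          · simpa [hji] using hz j hj)
        (fun j hj => by
          have hji : j ≠ i := fun h => hj (h ▸ hiI)
          simpa [hji] using hz0 j hj)
      rw [cdfVec_update] at this
      refine ⟨this.1, this.2.trans ?_⟩
      congr 2
      refine List.map_congr_left fun j hj => ?_
      have hji : j ≠ i := fun h => hl.1 (h ▸ hj)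
      rw [Function.update_of_ne hji]
    -- The factors collected so far do not involve coordinate `i`; being a nonzero constant, their
    -- product does not affect differentiability.
    have hK : (l.map fun j => p j * ψ j (z j)).prod ≠ 0 := by
      rw [Ne, List.prod_eq_zero_iff]
      simp only [List.mem_map, not_exists, not_and]
      intro j hj
      exact (mul_pos (hp j) (hz j (hlI j (List.mem_cons_of_mem i hj))).2).ne'
    have heq : (fun s => mixedPartial g l (Function.update z i s)) =ᶠ[𝓝 (z i)] fun s =>
        mixedPartial C l (Function.update (cdfVec p ψ z) i (marginalCdf (p i) (ψ i) s)) *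
            (l.map fun j => p j * ψ j (z j)).prod := hev.mono fun s hs => hs.2
    refine ⟨and_congr ?_ ?_, ?_⟩
    -- The marginal cdf maps neighbourhoods of `z i` onto neighbourhoods of its value, so existence
    -- for nearby points transfers both ways.
    · have hmap := hstrict.map_nhds_eq hne
      rw [Filter.eventually_congr (hev.mono fun s hs => hs.1), show cdfVec p ψ z i =
        marginalCdf (p i) (ψ i) (z i) from rfl, ← hmap, Filter.eventually_map]
    · rw [heq.differentiableAt_iff, differentiableAt_mul_const_iff hK]
      exact differentiableAt_comp_iff_of_strict
        (φ := fun r => mixedPartial C l (Function.update (cdfVec p ψ z) i r)) hstrict hne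
    · rw [mixedPartial, heq.deriv_eq, deriv_mul_const_field,
        deriv_comp_of_strict (φ := fun r => mixedPartial C l (Function.update (cdfVec p ψ z) i r))
          hstrict hne, List.map_cons, List.prod_cons, mixedPartial, mul_assoc]
      rfl

/-- For almost surely nonnegative `Y`, the events `Y_j = 0` and `Y_j ≤ 0` agree, so the probability
is a value of the joint cdf. -/
theorem activeProb_eq {d : ℕ} {Ω : Type*} [MeasurableSpace Ω] {P : Measure Ω}
    {Y : Ω → Fin d → ℝ} (hY : ∀ᵐ ω ∂P, ∀ i, 0 ≤ Y ω i) {I : Finset (Fin d)} {z : Fin d → ℝ}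
    (hz : ∀ i ∉ I, z i = 0) : activeProb P Y I z = P.real {ω | ∀ i, Y ω i ≤ z i} := by
  refine measureReal_congr ?_
  filter_upwards [hY] with ω hω
  refine propext ⟨?_, ?_⟩
  · rintro ⟨h1, h2⟩ i
    by_cases hi : i ∈ I
    · exact h1 i hi
    · rw [h2 i hi, hz i hi]
  · intro h
    exact ⟨fun i _ => h i, fun j hj => le_antisymm (hz j hj ▸ h j) (hω j)⟩

end CombBernoulli

end

/-! ### Assembly for the whole time series. -/

theorem mainTheorem1 {d N : ℕ} {Ω : Type*} [MeasurableSpace Ω]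
    (P : Measure Ω) [IsProbabilityMeasure P]
    (C : (Fin d → ℝ) → ℝ) (hC : CombBernoulli.IsAbsContCopula C)
    (p : Fin d → ℝ) (hp : ∀ i, p i ∈ Set.Ioc (0 : ℝ) 1)
    (ψ : Fin d → ℝ → ℝ) (hψ : ∀ i, CombBernoulli.IsSeverityDensity (ψ i))
    (X : Fin N → Ω → Fin d → ℝ) (hX : CombBernoulli.IsCombBernoulliSeries C p ψ P X) :
    -- the model has a density, so that the likelihood is well defined
    CombBernoulli.seriesLaw P X ≪ CombBernoulli.seriesRefMeasure N d ∧
    -- the log-likelihood formula, whatever the order of differentiation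
    (∀ᵐ x ∂(CombBernoulli.seriesRefMeasure N d), ∀ l : Fin N → List (Fin d),
      (∀ t, CombBernoulli.IsEnumeration (l t) (CombBernoulli.activeSet (x t))) →
      CombBernoulli.logLikelihood P X x =
        ∑ t, (CombBernoulli.eln (CombBernoulli.mixedPartial C (l t) (CombBernoulli.cdfVec p ψ (x t)))
          + ∑ i ∈ CombBernoulli.activeSet (x t), CombBernoulli.eln (p i * ψ i (x t i)))) ∧
    -- the mixed partial derivatives in the formula exist and are nonnegative
    (∀ᵐ x ∂(CombBernoulli.seriesRefMeasure N d), ∀ t, ∀ l : List (Fin d),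
      CombBernoulli.IsEnumeration l (CombBernoulli.activeSet (x t)) →
      (∀ i ∈ CombBernoulli.activeSet (x t), 0 < ψ i (x t i)) →
      CombBernoulli.HasMixedPartial C l (CombBernoulli.cdfVec p ψ (x t)) ∧
        0 ≤ CombBernoulli.mixedPartial C l (CombBernoulli.cdfVec p ψ (x t))) ∧
    -- for continuous severity densities, the formula for the likelihood that is obtained by
    -- differentiating the joint law in the active coordinates, at every single data set
    ((∀ i, ContinuousOn (ψ i) (Set.Ioi 0)) →
      ∀ x : Fin N → Fin d → ℝ, (∀ t i, 0 ≤ x t i) →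
      (∀ t, ∀ i ∈ CombBernoulli.activeSet (x t), 0 < ψ i (x t i)) →
      ∀ l : Fin N → List (Fin d),
      (∀ t, CombBernoulli.IsEnumeration (l t) (CombBernoulli.activeSet (x t))) →
      (∀ t, CombBernoulli.HasMixedPartial
          (CombBernoulli.activeProb P (X t) (CombBernoulli.activeSet (x t))) (l t) (x t) ↔
        CombBernoulli.HasMixedPartial C (l t) (CombBernoulli.cdfVec p ψ (x t))) ∧
      ∑ t, CombBernoulli.eln (CombBernoulli.mixedPartial
          (CombBernoulli.activeProb P (X t) (CombBernoulli.activeSet (x t))) (l t) (x t)) =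
        ∑ t, (CombBernoulli.eln (CombBernoulli.mixedPartial C (l t) (CombBernoulli.cdfVec p ψ (x t)))
          + ∑ i ∈ CombBernoulli.activeSet (x t), CombBernoulli.eln (p i * ψ i (x t i)))) := by
  open CombBernoulli in
  obtain ⟨c, hc, hc1, hCc⟩ := hC.exists_density
  have hfin : ∫⁻ u, c u ∂(cubeMeasure d) ≠ ⊤ := by rw [hc1]; exact ENNReal.one_ne_top
  obtain ⟨ρ, hρm, hρ⟩ := exists_measurable_density (p := p) hψ
  have hlaw : ∀ t, P.map (X t) = (refMeasure d).withDensity (obsDensity c p ψ ρ) := fun t => by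
    have : IsProbabilityMeasure (P.map (X t)) :=
      Measure.isProbabilityMeasure_map (hX.measurable t).aemeasurable
    refine eq_withDensity_obsDensity hp hψ hρm hρ hc hfin hCc _ fun x => ?_
    rw [← hX.cdf_eq t x, map_measureReal_apply (hX.measurable t) measurableSet_Iic]
    rfl
  have hdm : Measurable (obsDensity c p ψ ρ) := measurable_obsDensity hψ hρm hc
  have hseries : seriesLaw P X =
      (seriesRefMeasure N d).withDensity fun x => ∏ t, obsDensity c p ψ ρ (x t) := by
    have hprob : ∀ t : Fin N,
        SigmaFinite ((refMeasure d).withDensity (obsDensity c p ψ ρ)) := fun t => by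
      have : IsProbabilityMeasure (P.map (X t)) :=
        Measure.isProbabilityMeasure_map (hX.measurable t).aemeasurable
      rw [← hlaw t]; infer_instance
    rw [seriesLaw, (iIndepFun_iff_map_fun_eq_pi_map
      fun t => (hX.measurable t).aemeasurable).1 hX.indep]
    simp only [hlaw]
    exact @pi_withDensity N _ _ (fun _ => refMeasure d) _ (fun _ => obsDensity c p ψ ρ)
      (fun _ => hdm) hprob
  have hsig : SigmaFinite (seriesRefMeasure N d) := by
    unfold seriesRefMeasure; infer_instance
  have hobs : ∀ᵐ x ∂(seriesRefMeasure N d), ∀ t, ∀ l, IsEnumeration l (activeSet (x t)) →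
      ENNReal.log (obsDensity c p ψ ρ (x t)) = eln (mixedPartial C l (cdfVec p ψ (x t))) +
        ∑ i ∈ activeSet (x t), eln (p i * ψ i (x t i)) ∧
      ((∀ i ∈ activeSet (x t), 0 < ψ i (x t i)) → HasMixedPartial C l (cdfVec p ψ (x t)) ∧
        0 ≤ mixedPartial C l (cdfVec p ψ (x t))) :=
    ae_all_iff.2 fun t => (Measure.tendsto_eval_ae_ae (μ := fun _ : Fin N => refMeasure d)
      (i := t)).eventually (ae_log_obsDensity hp hψ hρm hρ hc hfin hCc)
  refine ⟨?_, ?_, ?_, ?_⟩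
  · rw [hseries]
    exact withDensity_absolutelyContinuous _ _
  · have hdens : likelihood P X =ᵐ[seriesRefMeasure N d]
        fun x => ∏ t, obsDensity c p ψ ρ (x t) := by
      rw [likelihood, hseries]
      exact Measure.rnDeriv_withDensity _
        (Finset.measurable_prod _ fun t _ => hdm.comp (measurable_pi_apply t))
    filter_upwards [hobs, hdens] with x hx hxd l hl
    rw [logLikelihood, hxd, log_finset_prod]
    exact Finset.sum_congr rfl fun t _ => (hx t (l t) (hl t)).1
  · filter_upwards [hobs] with x hx t l hl hpos using (hx t l hl).2 hpos
  · intro hcont x hx0 hpos l hl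
    have hnonneg : ∀ t, ∀ᵐ ω ∂P, ∀ i, 0 ≤ X t ω i := fun t => by
      refine ae_of_ae_map (hX.measurable t).aemeasurable (p := fun y => ∀ i, 0 ≤ y i) ?_
      rw [hlaw t]
      exact (withDensity_absolutelyContinuous _ _).ae_le (ae_refMeasure_nonneg d)
    have hact : ∀ t i, i ∈ activeSet (x t) ↔ 0 < x t i := fun t i => by simp [activeSet]
    have key := fun t => mixedPartial_comp_cdfVec (fun i => (hp i).1) hψ hcont
      (g := activeProb P (X t) (activeSet (x t))) (C := C) (I := activeSet (x t))
      (fun z _ hz0 => by rw [activeProb_eq (hnonneg t) hz0, hX.cdf_eq])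
      (l t) (hl t).1 (fun i hi => by rw [← (hl t).2]; exact List.mem_toFinset.2 hi) (x t)
      (fun i hi => ⟨(hact t i).1 hi, hpos t i hi⟩)
      (fun i hi => le_antisymm (not_lt.1 (mt (hact t i).2 hi)) (hx0 t i))
    refine ⟨fun t => (key t).1, Finset.sum_congr rfl fun t _ => ?_⟩
    -- Splitting `ENNReal.ofReal` of the product needs only the severity factors to be nonnegative;
    -- no sign of the mixed partial is required.
    rw [(key t).2, eln_add_sum_eln, ← List.prod_toFinset _ (hl t).1, (hl t).2, eln,
      ENNReal.ofReal_mul' (Finset.prod_nonneg fun i hi => (mul_pos (hp i).1 (hpos t i hi)).le),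
      ENNReal.ofReal_prod_of_nonneg fun i hi => (mul_pos (hp i).1 (hpos t i hi)).le]
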